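/- **Definitions.** For isomorphism classes $G, H$ of finite Abelian groups write $G \supseteq H$ if the groups in $G$ have a subgroup belonging to $H$. A *group-partition* of $G$ is a sequence $(G_j)_{j\ge 1}$ of isomorphism classes of finite Abelian groups with $$G = G_1\oplus G_2\oplus G_3\oplus\cdots,\qquad G_1\supseteq G_2\supseteq G_3\supseteq\cdots$$ (all but finitely many $G_j$ are then trivial). For $r = 1,2,3,\dots$ let $\pi_r(G)$ be the number of group-partitions of $G$ with at most $r$ factors, i.e. with $G_j$ trivial for all $j>r$, and let $\pi_\infty(G)$ be the number of all group-partitions of $G$. Put $a_r(n) := \sum_{|G|=n}\pi_r(G)$, where $G$ runs over the isomorphism classes of Abelian groups of order $n$. For a Dirichlet character $\chi$ (to any modulus) and $\mathrm{Re}(s)>1$ let $$J_r(s,\chi) := \sum_{n=1}^\infty \chi(n)\,a_r(n)\,n^{-s},\qquad L(s,\chi) := \sum_{n=1}^\infty \chi(n)\,n^{-s}.$$ **Proposition 3.1.** Let $r\in\{1,2,3,\dots\}\cup\{\infty\}$, let $\chi$ be a Dirichlet character, and let $\mathrm{Re}(s)>1$. Then the series $J_r(s,\chi)$ converges absolutely,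 and $$J_r(s,\chi) = \prod_{m=1}^\infty\ \prod_{p\ \mathrm{prime}} \bigl(1-\chi(p)^m p^{-ms}\bigr)^{-\min\{m,r\}} = \prod_{m=1}^\infty L(ms,\chi^m)^{\min\{m,r\}},$$ where $\min\{m,\infty\}=m$; for each $m$ the inner product over $p$ equals $L(ms,\chi^m)^{\min\{m,r\}}$. Both the double product over all pairs $(m,p)$ and the product over $m$ of the powers of $L$-series converge absolutely. (A product $\prod_i u_i$ is said to converge absolutely if $\sum_i |u_i-1|<\infty$.) -/

import Mathlib

open scoped DirectSum

/-- A finite Abelian group (written additively). -/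
structure FinAbGroup : Type 1 where
  /-- The underlying type. -/
  carrier : Type
  /-- The group structure. -/
  [addCommGroup : AddCommGroup carrier]
  /-- The group is finite. -/
  [finite : Finite carrier]

namespace FinAbGroup

instance : CoeSort FinAbGroup Type := ⟨FinAbGroup.carrier⟩

instance (A : FinAbGroup) : AddCommGroup A := A.addCommGroup

instance (A : FinAbGroup) : Finite A := A.finite

/-- Two finite Abelian groups are equivalent when they are isomorphic. -/
instance isoSetoid : Setoid FinAbGroup where
  r A B := Nonempty (A ≃+ B)
  iseqv :=
    { refl := fun A => ⟨AddEquiv.refl A⟩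
      symm := fun ⟨e⟩ => ⟨e.symm⟩
      trans := fun ⟨e⟩ ⟨f⟩ => ⟨e.trans f⟩ }

end FinAbGroup

/-- Isomorphism classes of finite Abelian groups. -/
def FinAbClass : Type 1 := Quotient FinAbGroup.isoSetoid

namespace FinAbClass

/-- The isomorphism class of a finite Abelian group. -/
def mk (A : FinAbGroup) : FinAbClass := Quotient.mk FinAbGroup.isoSetoid A

/-- A group in the isomorphism class `G`. All notions below depend only on the class, hence not
on the chosen representative. -/
noncomputable def rep (G : FinAbClass) : FinAbGroup := Quotient.out G

theorem mk_rep (G : FinAbClass) : mk G.rep = G := Quotient.out_eq G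

theorem mk_eq_mk {A B : FinAbGroup} : mk A = mk B ↔ Nonempty (A ≃+ B) := Quotient.eq

theorem nonempty_rep_mk (A : FinAbGroup) : Nonempty ((mk A).rep ≃+ A) :=
  mk_eq_mk.1 (mk_rep (mk A))

/-- The class of the trivial group. -/
def zeroClass : FinAbClass := mk ⟨PUnit⟩

/-- The order `|G|` of the groups in the class `G`. -/
noncomputable def order (G : FinAbClass) : ℕ := Nat.card G.rep

theorem order_mk (A : FinAbGroup) : (mk A).order = Nat.card A := by
  obtain ⟨e⟩ := nonempty_rep_mk A
  exact Nat.card_congr e.toEquiv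

/-- `Contains G H` is the relation `G ⊇ H` between isomorphism classes: the groups in `G` have a
subgroup that belongs to the class `H`. -/
def Contains (G H : FinAbClass) : Prop :=
  ∃ f : H.rep →+ G.rep, Function.Injective f

theorem contains_mk (A B : FinAbGroup) :
    Contains (mk A) (mk B) ↔ ∃ f : B →+ A, Function.Injective f := by
  obtain ⟨e⟩ := nonempty_rep_mk A
  obtain ⟨e'⟩ := nonempty_rep_mk B
  constructor
  · rintro ⟨f, hf⟩
    exact ⟨e.toAddMonoidHom.comp (f.comp e'.symm.toAddMonoidHom),
      e.injective.comp (hf.comp e'.symm.injective)⟩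
  · rintro ⟨f, hf⟩
    exact ⟨e.symm.toAddMonoidHom.comp (f.comp e'.toAddMonoidHom),
      e.symm.injective.comp (hf.comp e'.injective)⟩

/-- The sequence `g 0, g 1, g 2, …` of isomorphism classes is a group-partition of `G`:
`G = g 0 ⊕ g 1 ⊕ g 2 ⊕ ⋯` and `g 0 ⊇ g 1 ⊇ g 2 ⊇ ⋯`. As `G` is finite, all but
finitely many of the `g j` are then trivial, so that finite group-partitions are the sequences that
have been continued by trivial groups. -/
def IsGroupPartition (G : FinAbClass) (g : ℕ → FinAbClass) : Prop :=
  Nonempty (G.rep ≃+ ⨁ j, (g j).rep) ∧ ∀ j, Contains (g j) (g (j + 1))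

/-- `π_r(G)`: the number of group-partitions of `G` with at most `r` (nontrivial) factors.
For `r = ⊤` this is the number of all group-partitions of `G`. -/
noncomputable def partitionCount (r : ℕ∞) (G : FinAbClass) : ℕ :=
  Set.ncard {g : ℕ → FinAbClass |
    IsGroupPartition G g ∧ ∀ j : ℕ, r ≤ (j : ℕ∞) → g j = zeroClass}

end FinAbClass

/-- `a_r(n) = ∑_{|G| = n} π_r(G)`, the sum over the (finitely many) isomorphism classes `G` of
Abelian groups of order `n`. -/
noncomputable def groupPartitionFun (r : ℕ∞) (n : ℕ) : ℕ :=
  ∑ᶠ (G : FinAbClass) (_ : G.order = n), G.partitionCount r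

/-- The coefficients `χ(n) a_r(n)`. -/
noncomputable def groupPartitionCoeff (r : ℕ∞) {N : ℕ} (χ : DirichletCharacter ℂ N) (n : ℕ) : ℂ :=
  χ (n : ZMod N) * (groupPartitionFun r n : ℂ)

/-- The Dirichlet series `J_r(s, χ) = ∑_{n ≥ 1} χ(n) a_r(n) n^{-s}`. -/
noncomputable def groupPartitionSeries (r : ℕ∞) {N : ℕ} (χ : DirichletCharacter ℂ N) (s : ℂ) : ℂ :=
  LSeries (groupPartitionCoeff r χ) s

/-- The Dirichlet `L`-series `L(s, χ) = ∑_{n ≥ 1} χ(n) n^{-s}`. -/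
noncomputable def dirichletL {N : ℕ} (χ : DirichletCharacter ℂ N) (s : ℂ) : ℂ :=
  LSeries (fun n : ℕ => χ (n : ZMod N)) s

/-- `min {m, r}`, a natural number also for `r = ∞`. -/
noncomputable def minExponent (m : ℕ) (r : ℕ∞) : ℕ := (min (m : ℕ∞) r).toNat

theorem minExponent_top (m : ℕ) : minExponent m ⊤ = m := by
  simp [minExponent]

theorem minExponent_coe (m r : ℕ) : minExponent m (r : ℕ∞) = min m r := by
  rcases le_total m r with h | h
  · rw [minExponent, min_eq_left (Nat.cast_le.2 h), ENat.toNat_natCast, min_eq_left h]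
  · rw [minExponent, min_eq_right (Nat.cast_le.2 h), ENat.toNat_natCast, min_eq_right h]

/-- The Euler factor `(1 - χ(p)^m p^{-ms})^{-min{m, r}}`. -/
noncomputable def groupPartitionEulerFactor (r : ℕ∞) {N : ℕ} (χ : DirichletCharacter ℂ N) (s : ℂ)
    (m : ℕ) (p : ℕ) : ℂ :=
  ((1 - χ (p : ZMod N) ^ m * (p : ℂ) ^ (-((m : ℂ) * s))) ^ minExponent m r)⁻¹

/-! At each prime `p` a finite Abelian group is described by the ranks of the `p`-torsion of `p ^ i
A`, `i = 0, 1, …`. These form the conjugate of the partition of exponents of its cyclic `p`-factors.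
One group embeds in another exactly when its ranks are at most those of the other. Every finitely
supported family of decreasing sequences occurs, and the exponent of `p` in the order is the sum of
the ranks. A descending chain of groups with at most `r` nontrivial terms is therefore a finitely
supported family, indexed by the primes, of plane partitions with at most `r` rows: row `j` at `p`
lists the ranks of the `j`th group (`exists_chains_equiv`).

MacMahon's theorem trades plane partitions of size `n` for arbitrary finitely supported arrays on
the cells `(i, j)`, `i < r`, in which a cell weighs `i + j + 1` (`exists_planePartition_equiv`). It
is proved by cutting a plane partition into diagonals, which interlace. A bijective local rule
(`growthEquiv`) commutes summation over larger and over smaller neighbours at the cost of one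
geometric series, which produces one factor for each cell of a rectangle. Equality of generating
functions then gives equal coefficients.

Hence `a_r(n)` counts the exponent arrays on primes and cells whose product of powers `p ^ (i + j +
1)` is `n`. Since `χ(n) n^{-s}` is completely multiplicative, the Dirichlet series is a sum of
monomials over all arrays, that is, a product of geometric series over pairs of a prime and a cell.
Exactly `min {m, r}` cells have `i + j + 1 = m`; collecting them gives the Euler factors, and the
product over `p` for fixed `m` is a power of an `L`-series. Absolute convergence is checked for the
ungrouped product and inherited by each grouping. -/

section

open Finset Function

/-! ### Interlacing partitions and the local growth rule. -/

noncomputable section Interlacing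

/-- Integer partitions, as weakly decreasing finitely supported sequences. -/
abbrev DecSeq : Type := {f : ℕ →₀ ℕ // Antitone f}

instance : Zero DecSeq := ⟨⟨0, fun _ _ _ => le_rfl⟩⟩

/-- The size of a partition. -/
def DecSeq.size (f : DecSeq) : ℕ := f.1.degree

/-- `κ` and `μ` interlace: `μ 0 ≥ κ 0 ≥ μ 1 ≥ κ 1 ≥ ⋯`. -/
def Interlaces (κ μ : DecSeq) : Prop := ∀ i, κ.1 i ≤ μ.1 i ∧ μ.1 (i + 1) ≤ κ.1 i

@[simp] lemma DecSeq.zero_apply (i : ℕ) : (0 : DecSeq).1 i = 0 := rfl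

@[simp] lemma DecSeq.size_zero : (0 : DecSeq).size = 0 := map_zero Finsupp.degree

lemma DecSeq.ext_apply {f g : DecSeq} (h : ∀ i, f.1 i = g.1 i) : f = g :=
  Subtype.ext (Finsupp.ext h)

lemma Finsupp.exists_forall_ge_eq_zero (f : ℕ →₀ ℕ) : ∃ N, ∀ i, N ≤ i → f i = 0 := by
  obtain ⟨N, hN⟩ := f.support.exists_nat_subset_range
  refine ⟨N, fun i hi => ?_⟩
  by_contra h
  have := hN (Finsupp.mem_support_iff.2 h)
  simp at this
  omega

lemma Finsupp.degree_eq_sum_range (f : ℕ →₀ ℕ) {N : ℕ} (h : ∀ i, N ≤ i → f i = 0) :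
    f.degree = ∑ i ∈ range N, f i := by
  rw [Finsupp.degree_apply]
  refine Finset.sum_subset (fun i hi => ?_) (fun i _ hi => by simpa using hi)
  by_contra hN
  exact (Finsupp.mem_support_iff.1 hi) (h i (by simpa using hN))

/-- A weakly decreasing sequence that vanishes somewhere is a partition. -/
def DecSeq.ofFun (f : ℕ → ℕ) (hf : Antitone f) (h : ∃ N, f N = 0) : DecSeq :=
  ⟨Finsupp.ofSupportFinite f (by
    obtain ⟨N, hN⟩ := h
    refine (Set.finite_Iio N).subset fun i hi => ?_
    by_contra hi'
    exact hi (Nat.le_zero.1 (hN ▸ hf (not_lt.1 hi')))), hf⟩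

@[simp] lemma DecSeq.ofFun_apply (f : ℕ → ℕ) (hf : Antitone f) (h : ∃ N, f N = 0) (i : ℕ) :
    (DecSeq.ofFun f hf h).1 i = f i := rfl

lemma DecSeq.exists_eq_zero (f : DecSeq) : ∃ N, ∀ i, N ≤ i → f.1 i = 0 :=
  f.1.exists_forall_ge_eq_zero

/-- The sequence `a, b 0, b 1, …`. -/
def consSeq {α : Type*} (a : α) (b : ℕ → α) : ℕ → α
  | 0 => a
  | i + 1 => b i

@[simp] lemma consSeq_zero {α : Type*} (a : α) (b : ℕ → α) : consSeq a b 0 = a := rfl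

@[simp] lemma consSeq_succ {α : Type*} (a : α) (b : ℕ → α) (i : ℕ) :
    consSeq a b (i + 1) = b i := rfl

/-- The local rule: adding a box to a growth diagram. -/
def growthEquiv (lam nu : DecSeq) :
    {μ // Interlaces lam μ ∧ Interlaces nu μ} ≃ {κ // Interlaces κ lam ∧ Interlaces κ nu} × ℕ where
  toFun μ :=
    -- The entries `μ (i + 1)` and `κ i` are confined to the same interval, from the maximum at `i +
    -- 1` to the minimum at `i` of `lam` and `nu`; the rule reflects this interval. Only `μ 0` is
    -- unbounded above, and its excess over the maximum is the extra natural number.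
    (⟨DecSeq.ofFun
      (fun i => min (lam.1 i) (nu.1 i) + max (lam.1 (i + 1)) (nu.1 (i + 1)) - μ.1.1 (i + 1))
      (antitone_nat_of_succ_le fun i => by
        have h1 := μ.2.1 i; have h2 := μ.2.2 i
        have h3 := μ.2.1 (i + 1); have h4 := μ.2.2 (i + 1)
        have h5 := μ.2.1 (i + 1 + 1); have h6 := μ.2.2 (i + 1 + 1)
        omega)
      (by
        obtain ⟨N, hN⟩ := lam.exists_eq_zero
        refine ⟨N, ?_⟩
        have h1 := μ.2.1 N; have h2 := μ.2.2 N
        have h3 := μ.2.1 (N + 1); have h4 := μ.2.2 (N + 1)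
        have := hN N le_rfl
        omega),
      by
        refine ⟨fun i => ?_, fun i => ?_⟩ <;>
        · have h1 := μ.2.1 i; have h2 := μ.2.2 i
          have h3 := μ.2.1 (i + 1); have h4 := μ.2.2 (i + 1)
          simp only [DecSeq.ofFun_apply]
          omega⟩,
      μ.1.1 0 - max (lam.1 0) (nu.1 0))
  invFun κ :=
    ⟨DecSeq.ofFun
      (consSeq (max (lam.1 0) (nu.1 0) + κ.2) fun i =>
        min (lam.1 i) (nu.1 i) + max (lam.1 (i + 1)) (nu.1 (i + 1)) - κ.1.1.1 i)
      (antitone_nat_of_succ_le fun i => by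
        have h1 := κ.1.2.1 i; have h2 := κ.1.2.2 i
        cases i with
        | zero => simp only [consSeq_zero, consSeq_succ]; omega
        | succ i =>
          have h3 := κ.1.2.1 i; have h4 := κ.1.2.2 i
          simp only [consSeq_succ]; omega)
      (by
        obtain ⟨N, hN⟩ := lam.exists_eq_zero
        refine ⟨N + 1, ?_⟩
        have h1 := κ.1.2.1 N; have h2 := κ.1.2.2 N
        have := hN N le_rfl
        simp only [consSeq_succ]
        omega),
      by
        refine ⟨fun i => ?_, fun i => ?_⟩ <;>
        · have h1 := κ.1.2.1 i; have h2 := κ.1.2.2 i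
          cases i with
          | zero => simp only [DecSeq.ofFun_apply, consSeq_zero, consSeq_succ]; omega
          | succ i =>
            have h3 := κ.1.2.1 i; have h4 := κ.1.2.2 i
            simp only [DecSeq.ofFun_apply, consSeq_succ]; omega⟩
  left_inv μ := by
    refine Subtype.ext (DecSeq.ext_apply fun i => ?_)
    cases i with
    | zero =>
      have h1 := μ.2.1 0; have h2 := μ.2.2 0
      simp only [DecSeq.ofFun_apply, consSeq_zero]; omega
    | succ i =>
      have h1 := μ.2.1 i; have h2 := μ.2.2 i
      have h3 := μ.2.1 (i + 1); have h4 := μ.2.2 (i + 1)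
      simp only [DecSeq.ofFun_apply, consSeq_succ]; omega
  right_inv κ := by
    refine Prod.ext (Subtype.ext (DecSeq.ext_apply fun i => ?_)) ?_
    · have h1 := κ.1.2.1 i; have h2 := κ.1.2.2 i
      simp only [DecSeq.ofFun_apply, consSeq_succ]; omega
    · simp only [DecSeq.ofFun_apply, consSeq_zero]; omega

/-- The reflection makes `μ (i + 1) + κ i` the sum of a minimum at `i` and a maximum at `i + 1`.
Summed over `i`, together with `μ 0`, the minima and maxima recombine into the entries of `lam` and
`nu`. -/
lemma size_growthEquiv (lam nu : DecSeq) (μ : {μ // Interlaces lam μ ∧ Interlaces nu μ}) :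
    μ.1.size + (growthEquiv lam nu μ).1.1.size =
      lam.size + nu.size + (growthEquiv lam nu μ).2 := by
  obtain ⟨N₁, h₁⟩ := lam.exists_eq_zero
  obtain ⟨N₂, h₂⟩ := nu.exists_eq_zero
  set N := max N₁ N₂ with hN
  have hl : ∀ i, N ≤ i → lam.1 i = 0 := fun i hi => h₁ i (by omega)
  have hn : ∀ i, N ≤ i → nu.1 i = 0 := fun i hi => h₂ i (by omega)
  have hm : ∀ i, N + 1 ≤ i → μ.1.1 i = 0 := by
    rintro (_ | i) hi
    · omega
    · have := μ.2.1 i; have := hl i (by omega); omega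
  have hk : ∀ i, N ≤ i → (growthEquiv lam nu μ).1.1.1 i = 0 := by
    intro i hi
    have := (growthEquiv lam nu μ).1.2.1 i; have := hl i (by omega); omega
  have ha : μ.1.1 0 = max (lam.1 0) (nu.1 0) + (growthEquiv lam nu μ).2 := by
    have h1 := μ.2.1 0; have h2 := μ.2.2 0
    simp only [growthEquiv, Equiv.coe_fn_mk]; omega
  have hs : ∀ i, μ.1.1 (i + 1) + (growthEquiv lam nu μ).1.1.1 i =
      min (lam.1 i) (nu.1 i) + max (lam.1 (i + 1)) (nu.1 (i + 1)) := by
    intro i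
    have h1 := μ.2.1 i; have h2 := μ.2.2 i
    have h3 := μ.2.1 (i + 1); have h4 := μ.2.2 (i + 1)
    simp only [growthEquiv, Equiv.coe_fn_mk, DecSeq.ofFun_apply]; omega
  have hmax := Finset.sum_range_succ' (fun i => max (lam.1 i) (nu.1 i)) N
  have hmax' := Finset.sum_range_succ (fun i => max (lam.1 i) (nu.1 i)) N
  simp only [hl N le_rfl, hn N le_rfl, max_self] at hmax'
  have hsum : ∑ i ∈ range N, (μ.1.1 (i + 1) + (growthEquiv lam nu μ).1.1.1 i) =
      ∑ i ∈ range N, (min (lam.1 i) (nu.1 i) + max (lam.1 (i + 1)) (nu.1 (i + 1))) :=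
    Finset.sum_congr rfl fun i _ => hs i
  have hmm : ∑ i ∈ range N, (min (lam.1 i) (nu.1 i) + max (lam.1 i) (nu.1 i)) =
      ∑ i ∈ range N, (lam.1 i + nu.1 i) :=
    Finset.sum_congr rfl fun i _ => min_add_max _ _
  rw [Finset.sum_add_distrib, Finset.sum_add_distrib] at hsum hmm
  simp only [DecSeq.size]
  rw [Finsupp.degree_eq_sum_range _ hm, Finsupp.degree_eq_sum_range _ hk,
    Finsupp.degree_eq_sum_range _ hl, Finsupp.degree_eq_sum_range _ hn, Finset.sum_range_succ', ha]
  omega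

end Interlacing

/-! ### Generating functions of interlacing chains. -/

noncomputable section ChainSums

open Classical in
/-- The generating function, by total size, of the chains `lam ≻ κ₁ ≻ ⋯ ≻ κ_c = 0`. -/
def chainSum (x : ENNReal) : ℕ → DecSeq → ENNReal
  | 0, lam => if lam = 0 then 1 else 0
  | c + 1, lam => ∑' κ, if Interlaces κ lam then x ^ κ.size * chainSum x c κ else 0

lemma interlaces_zero_right {lam : DecSeq} : Interlaces lam 0 ↔ lam = 0 := by
  constructor
  · intro h
    exact DecSeq.ext_apply fun i => Nat.le_zero.1 (h i).1
  · rintro rfl i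
    simp

lemma chainSum_zero_right (x : ENNReal) (c : ℕ) : chainSum x c 0 = 1 := by
  classical
  induction c with
  | zero => simp [chainSum]
  | succ c ih =>
    simp only [chainSum, interlaces_zero_right]
    rw [tsum_eq_single 0 (fun b hb => if_neg hb)]
    simp [ih]

lemma tsum_ite_zero {α : Type*} (p : α → Prop) [DecidablePred p] (f : α → ENNReal) :
    ∑' a, (if p a then f a else 0) = ∑' a : {a // p a}, f a := by
  have h := tsum_subtype {a | p a} f
  refine Eq.trans ?_ h.symm
  exact tsum_congr fun a => by by_cases h : p a <;> simp [h]

-- The commutation relation between summing over larger and over smaller neighbours. The free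
-- natural number in `growthEquiv` contributes the geometric series `(1 - t)⁻¹`.
open Classical in
lemma tsum_growth (t : ENNReal) (ht : t ≠ 0) (ht' : t ≠ ⊤) (lam nu : DecSeq) :
    ∑' μ : DecSeq, (if Interlaces lam μ ∧ Interlaces nu μ then t ^ μ.size else 0) =
      (1 - t)⁻¹ * ∑' κ : DecSeq, (if Interlaces κ lam ∧ Interlaces κ nu then
        t ^ lam.size * t ^ nu.size * (t ^ κ.size)⁻¹ else 0) := by
  rw [tsum_ite_zero, tsum_ite_zero, ← (growthEquiv lam nu).symm.tsum_eq, ENNReal.tsum_prod', mul_comm,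
    ← ENNReal.tsum_mul_right]
  refine tsum_congr fun κ => ?_
  rw [← ENNReal.tsum_geometric, ← ENNReal.tsum_mul_left]
  refine tsum_congr fun a => ?_
  have h := size_growthEquiv lam nu ((growthEquiv lam nu).symm (κ, a))
  rw [Equiv.apply_symm_apply] at h
  have h0 : t ^ κ.1.size ≠ 0 := pow_ne_zero _ ht
  have h0' : t ^ κ.1.size ≠ ⊤ := ENNReal.pow_ne_top ht'
  rw [mul_right_comm, ← div_eq_mul_inv, ENNReal.eq_div_iff h0 h0', ← pow_add, ← pow_add, ← pow_add,
    add_comm, h]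

-- The upward sum is pushed through the chain by `tsum_growth`, one link at a time. Each exchange
-- costs `(1 - t)⁻¹`, and the size weight of the next link turns `t` into `t * x`.
open Classical in
lemma tsum_chainSum_above (x : ENNReal) (hx : x ≠ 0) (hx' : x ≠ ⊤) (c : ℕ) :
    ∀ (t : ENNReal), t ≠ 0 → t ≠ ⊤ → ∀ lam : DecSeq,
    ∑' μ : DecSeq, (if Interlaces lam μ then chainSum x c μ * t ^ μ.size else 0) =
      (∏ j ∈ range c, (1 - t * x ^ j)⁻¹) * (t ^ lam.size * chainSum x c lam) := by
  induction c with
  | zero =>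
    intro t ht ht' lam
    rw [tsum_eq_single 0 (fun μ hμ => by simp [chainSum, hμ])]
    by_cases h : lam = 0 <;> simp [chainSum, interlaces_zero_right, h]
  | succ c ih =>
    intro t ht ht' lam
    have key : ∀ κ : DecSeq, ∑' ν : DecSeq, (if Interlaces κ ν then
        chainSum x c ν * (t * x) ^ ν.size else 0) = _ :=
      ih (t * x) (mul_ne_zero ht hx) (ENNReal.mul_ne_top ht' hx')
    calc ∑' μ : DecSeq, (if Interlaces lam μ then chainSum x (c + 1) μ * t ^ μ.size else 0)
        = ∑' (μ : DecSeq) (ν : DecSeq), (x ^ ν.size * chainSum x c ν) *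
            (if Interlaces lam μ ∧ Interlaces ν μ then t ^ μ.size else 0) := by
          refine tsum_congr fun μ => ?_
          by_cases h : Interlaces lam μ
          · simp only [h, if_true, true_and, chainSum]
            rw [← ENNReal.tsum_mul_right]
            refine tsum_congr fun ν => ?_
            split_ifs <;> simp
          · simp [h]
      _ = ∑' (ν : DecSeq) (κ : DecSeq), (x ^ ν.size * chainSum x c ν) * ((1 - t)⁻¹ *
            (if Interlaces κ lam ∧ Interlaces κ ν then
              t ^ lam.size * t ^ ν.size * (t ^ κ.size)⁻¹ else 0)) := by
          rw [ENNReal.tsum_comm]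
          refine tsum_congr fun ν => ?_
          rw [ENNReal.tsum_mul_left, tsum_growth t ht ht', ENNReal.tsum_mul_left,
            ENNReal.tsum_mul_left]
      _ = ∑' (κ : DecSeq), (1 - t)⁻¹ * (if Interlaces κ lam then
            t ^ lam.size * (t ^ κ.size)⁻¹ * ∑' ν : DecSeq, (if Interlaces κ ν then
              chainSum x c ν * (t * x) ^ ν.size else 0) else 0) := by
          rw [ENNReal.tsum_comm]
          refine tsum_congr fun κ => ?_
          by_cases h : Interlaces κ lam
          · simp only [h, if_true, true_and]
            rw [← ENNReal.tsum_mul_left, ← ENNReal.tsum_mul_left]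
            refine tsum_congr fun ν => ?_
            split_ifs
            · rw [mul_pow]; ring
            · simp
          · simp [h]
      _ = _ := by
          rw [ENNReal.tsum_mul_left, Finset.prod_range_succ', chainSum]
          simp only [key, pow_zero, mul_one]
          rw [mul_comm (∏ _ ∈ _, _), mul_assoc, ← mul_assoc (∏ _ ∈ _, _)]
          congr 1
          rw [← ENNReal.tsum_mul_left]
          refine tsum_congr fun κ => ?_
          split_ifs
          · have h0 : t ^ κ.size ≠ 0 := pow_ne_zero _ ht
            have h0' : t ^ κ.size ≠ ⊤ := ENNReal.pow_ne_top ht'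
            have e : ∀ j, t * x * x ^ j = t * x ^ (j + 1) := fun j => by rw [pow_succ']; ring
            simp only [e]
            calc t ^ lam.size * (t ^ κ.size)⁻¹ * ((∏ j ∈ range c, (1 - t * x ^ (j + 1))⁻¹) *
                  ((t * x) ^ κ.size * chainSum x c κ))
                = ((t ^ κ.size)⁻¹ * t ^ κ.size) * ((∏ j ∈ range c, (1 - t * x ^ (j + 1))⁻¹) *
                  t ^ lam.size * (x ^ κ.size * chainSum x c κ)) := by rw [mul_pow]; ring
              _ = _ := by rw [ENNReal.inv_mul_cancel h0 h0', one_mul]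
          · simp

/-- The generating function of pairs of chains with common top. -/
lemma tsum_chainSum_mul (x : ENNReal) (hx : x ≠ 0) (hx' : x ≠ ⊤) (c r : ℕ) :
    ∀ (t : ENNReal), t ≠ 0 → t ≠ ⊤ →
    ∑' μ : DecSeq, chainSum x c μ * t ^ μ.size * chainSum x r μ =
      ∏ i ∈ range r, ∏ j ∈ range c, (1 - t * x ^ (i + j))⁻¹ := by
  classical
  induction r with
  | zero =>
    intro t _ _
    rw [tsum_eq_single 0 (fun μ hμ => by simp [chainSum, hμ])]
    simp [chainSum_zero_right]
  | succ r ih =>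
    intro t ht ht'
    -- Peel the top link off the second chain: the sum over `μ` above `κ` is `tsum_chainSum_above`,
    -- and `κ` becomes the new common top, with weight `t * x`.
    calc ∑' μ : DecSeq, chainSum x c μ * t ^ μ.size * chainSum x (r + 1) μ
        = ∑' (μ : DecSeq) (κ : DecSeq), (x ^ κ.size * chainSum x r κ) *
            (if Interlaces κ μ then chainSum x c μ * t ^ μ.size else 0) := by
          refine tsum_congr fun μ => ?_
          rw [chainSum, ← ENNReal.tsum_mul_left]
          refine tsum_congr fun κ => ?_
          split_ifs
          · ring
          · simp
      _ = ∑' κ : DecSeq, (∏ j ∈ range c, (1 - t * x ^ j)⁻¹) *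
            (chainSum x c κ * (t * x) ^ κ.size * chainSum x r κ) := by
          rw [ENNReal.tsum_comm]
          refine tsum_congr fun κ => ?_
          rw [ENNReal.tsum_mul_left, tsum_chainSum_above x hx hx' c t ht ht', mul_pow]
          ring
      _ = _ := by
          rw [ENNReal.tsum_mul_left, ih (t * x) (mul_ne_zero ht hx) (ENNReal.mul_ne_top ht' hx'),
            Finset.prod_range_succ', mul_comm]
          congr 1
          · refine Finset.prod_congr rfl fun i _ => Finset.prod_congr rfl fun j _ => ?_
            rw [add_right_comm, pow_succ']
            ring_nf
          · simp

end ChainSums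

/-! ### Plane partitions in a rectangle, by diagonals. -/

noncomputable section PlanePartitions

/-- Interlacing chains `Λ 0 ≻ Λ 1 ≻ ⋯` with `Λ k = 0` for `c ≤ k`. -/
abbrev InterlacingChain (c : ℕ) : Type :=
  {L : ℕ → DecSeq // (∀ k, Interlaces (L (k + 1)) (L k)) ∧ ∀ k, c ≤ k → L k = 0}

/-- The total size of a chain, without its top. -/
def InterlacingChain.tailSize {c : ℕ} (L : InterlacingChain c) : ℕ :=
  ∑ k ∈ range c, (L.1 (k + 1)).size

/-- A chain is its top together with the chain below the top. -/
def InterlacingChain.consEquiv (c : ℕ) : InterlacingChain (c + 1) ≃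
    {p : DecSeq × InterlacingChain c // Interlaces (p.2.1 0) p.1} where
  toFun L := ⟨(L.1 0, ⟨fun k => L.1 (k + 1), fun k => L.2.1 (k + 1),
    fun k hk => L.2.2 (k + 1) (by omega)⟩), L.2.1 0⟩
  invFun p := ⟨consSeq p.1.1 p.1.2.1, by
    rintro (_ | k)
    · exact p.2
    · exact p.1.2.2.1 k, by
    rintro (_ | k) hk
    · omega
    · exact p.1.2.2.2 k (by omega)⟩
  left_inv L := by
    refine Subtype.ext (funext fun k => ?_)
    cases k <;> rfl
  right_inv p := rfl

lemma InterlacingChain.tailSize_cons {c : ℕ} (L : InterlacingChain (c + 1)) :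
    L.tailSize = (L.1 1).size + (InterlacingChain.consEquiv c L).1.2.tailSize := by
  rw [tailSize, Finset.sum_range_succ', add_comm]
  rfl

open Classical in
lemma chainSum_eq_tsum (x : ENNReal) (c : ℕ) : ∀ lam : DecSeq,
    chainSum x c lam = ∑' L : InterlacingChain c, if L.1 0 = lam then x ^ L.tailSize else 0 := by
  induction c with
  | zero =>
    intro lam
    rw [tsum_eq_single (⟨fun _ => 0, fun _ => interlaces_zero_right.2 rfl, fun _ _ => rfl⟩ :
      InterlacingChain 0) (fun L hL => (hL (Subtype.ext (funext fun k => L.2.2 k (by omega)))).elim)]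
    simp [chainSum, InterlacingChain.tailSize, eq_comm]
  | succ c ih =>
    intro lam
    rw [← (InterlacingChain.consEquiv c).symm.tsum_eq, chainSum]
    have h : ∀ p : {p : DecSeq × InterlacingChain c // Interlaces (p.2.1 0) p.1},
        (if ((InterlacingChain.consEquiv c).symm p).1 0 = lam then
          x ^ ((InterlacingChain.consEquiv c).symm p).tailSize else 0) =
        if p.1.1 = lam then x ^ (p.1.2.1 0).size * x ^ p.1.2.tailSize else 0 := by
      intro p
      rw [InterlacingChain.tailSize_cons, Equiv.apply_symm_apply, pow_add]
      rfl
    simp only [h]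
    symm
    rw [← tsum_ite_zero (fun p : DecSeq × InterlacingChain c => Interlaces (p.2.1 0) p.1)
      (fun p => if p.1 = lam then x ^ (p.2.1 0).size * x ^ p.2.tailSize else 0),
      ENNReal.tsum_prod', tsum_eq_single lam (fun μ hμ => by simp [hμ])]
    simp only [ih, if_true]
    symm
    calc _ = ∑' (κ : DecSeq) (L : InterlacingChain c), (if L.1 0 = κ then
          (if Interlaces (L.1 0) lam then x ^ (L.1 0).size * x ^ L.tailSize else 0) else 0) := by
          refine tsum_congr fun κ => ?_
          rw [← ENNReal.tsum_mul_left]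
          by_cases h : Interlaces κ lam
          · rw [if_pos h]
            refine tsum_congr fun L => ?_
            by_cases h' : L.1 0 = κ
            · simp [h', h]
            · simp [h']
          · rw [if_neg h, eq_comm, ENNReal.tsum_eq_zero]
            intro L
            by_cases h' : L.1 0 = κ
            · simp [h', h]
            · simp [h']
      _ = _ := by
          rw [ENNReal.tsum_comm]
          refine tsum_congr fun L => ?_
          rw [tsum_eq_single (L.1 0) (fun κ hκ => by simp [hκ.symm])]
          simp

/-- Plane partitions with at most `r` rows and at most `c` columns. -/
def IsPlanePartition (r c : ℕ∞) (f : ℕ × ℕ →₀ ℕ) : Prop :=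
  Antitone f ∧ ∀ i j : ℕ, r ≤ i ∨ c ≤ j → f (i, j) = 0

lemma antitone_prod_of_succ {f : ℕ × ℕ → ℕ} (h1 : ∀ i j, f (i + 1, j) ≤ f (i, j))
    (h2 : ∀ i j, f (i, j + 1) ≤ f (i, j)) : Antitone f := by
  rintro ⟨i, j⟩ ⟨i', j'⟩ ⟨hi, hj⟩
  exact (antitone_nat_of_succ_le (f := fun i => f (i, j')) (fun i => h1 i j') hi).trans
    (antitone_nat_of_succ_le (f := fun j => f (i, j)) (fun j => h2 i j) hj)

lemma IsPlanePartition.succ_left {r c : ℕ∞} {f : ℕ × ℕ →₀ ℕ} (h : IsPlanePartition r c f)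
    (i j : ℕ) : f (i + 1, j) ≤ f (i, j) := h.1 ⟨Nat.le_succ i, le_rfl⟩

lemma IsPlanePartition.succ_right {r c : ℕ∞} {f : ℕ × ℕ →₀ ℕ} (h : IsPlanePartition r c f)
    (i j : ℕ) : f (i, j + 1) ≤ f (i, j) := h.1 ⟨le_rfl, Nat.le_succ j⟩

lemma IsPlanePartition.diag {r c : ℕ∞} {f : ℕ × ℕ →₀ ℕ} (h : IsPlanePartition r c f)
    (i j : ℕ) : f (i + 1, j + 1) ≤ f (i, j) := h.1 ⟨Nat.le_succ i, Nat.le_succ j⟩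

/-- The entries of a pair of chains of diagonals as an array. -/
def arrayOfDiagonals (L M : ℕ → DecSeq) (p : ℕ × ℕ) : ℕ :=
  if p.1 ≤ p.2 then (L (p.2 - p.1)).1 p.1 else (M (p.1 - p.2)).1 p.2

lemma arrayOfDiagonals_upper (L M : ℕ → DecSeq) (i k : ℕ) :
    arrayOfDiagonals L M (i, i + k) = (L k).1 i := by
  simp [arrayOfDiagonals]

lemma arrayOfDiagonals_lower (L M : ℕ → DecSeq) (h : L 0 = M 0) (i k : ℕ) :
    arrayOfDiagonals L M (i + k, i) = (M k).1 i := by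
  rcases k with _ | k
  · simp [arrayOfDiagonals, h]
  · simp [arrayOfDiagonals]

/-- One step in the array passes to a neighbouring diagonal, so the two inequalities of interlacing
are the horizontal and the vertical comparison. -/
lemma antitone_arrayOfDiagonals (L M : ℕ → DecSeq) (h : L 0 = M 0)
    (hL : ∀ k, Interlaces (L (k + 1)) (L k)) (hM : ∀ k, Interlaces (M (k + 1)) (M k)) :
    Antitone (arrayOfDiagonals L M) := by
  refine antitone_prod_of_succ (fun i j => ?_) (fun i j => ?_)
  · rcases Nat.lt_or_ge i j with hij | hij
    · obtain ⟨k, rfl⟩ := Nat.exists_eq_add_of_le (Nat.succ_le_of_lt hij)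
      have h1 := arrayOfDiagonals_upper L M (i + 1) k
      have h2 := arrayOfDiagonals_upper L M i (k + 1)
      rw [add_right_comm, add_assoc] at h1
      rw [Nat.succ_eq_add_one, add_right_comm, add_assoc, h1, h2]
      exact (hL k i).2
    · obtain ⟨k, rfl⟩ := Nat.exists_eq_add_of_le hij
      rw [add_assoc, arrayOfDiagonals_lower L M h, arrayOfDiagonals_lower L M h]
      exact (hM k j).1
  · rcases Nat.lt_or_ge j i with hij | hij
    · obtain ⟨k, rfl⟩ := Nat.exists_eq_add_of_le (Nat.succ_le_of_lt hij)
      have h1 := arrayOfDiagonals_lower L M h (j + 1) k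
      have h2 := arrayOfDiagonals_lower L M h j (k + 1)
      rw [add_right_comm, add_assoc] at h1
      rw [Nat.succ_eq_add_one, add_right_comm, add_assoc, h1, h2]
      exact (hM k j).2
    · obtain ⟨k, rfl⟩ := Nat.exists_eq_add_of_le hij
      rw [add_assoc, arrayOfDiagonals_upper, arrayOfDiagonals_upper]
      exact (hL k i).1

lemma arrayOfDiagonals_eq_zero {r c : ℕ} (p : {p : InterlacingChain c × InterlacingChain r //
    p.1.1 0 = p.2.1 0}) (i j : ℕ) (hij : r ≤ i ∨ c ≤ j) :
    arrayOfDiagonals p.1.1.1 p.1.2.1 (i, j) = 0 := by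
  have hanti := antitone_arrayOfDiagonals _ _ p.2 p.1.1.2.1 p.1.2.2.1
  refine Nat.le_zero.1 ?_
  rcases hij with h | h
  · have := arrayOfDiagonals_lower _ _ p.2 0 r
    rw [p.1.2.2.2 r le_rfl, zero_add] at this
    exact (hanti (show ((r, 0) : ℕ × ℕ) ≤ (i, j) from ⟨h, Nat.zero_le _⟩)).trans this.le
  · have := arrayOfDiagonals_upper p.1.1.1 p.1.2.1 0 c
    rw [p.1.1.2.2 c le_rfl, zero_add] at this
    exact (hanti (show ((0, c) : ℕ × ℕ) ≤ (i, j) from ⟨Nat.zero_le _, h⟩)).trans this.le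

/-- A plane partition is the pair of chains of its upper and of its lower diagonals. -/
def diagonalsEquiv (r c : ℕ) : {f // IsPlanePartition r c f} ≃
    {p : InterlacingChain c × InterlacingChain r // p.1.1 0 = p.2.1 0} where
  toFun f :=
    ⟨(⟨fun k => DecSeq.ofFun (fun i => f.1 (i, i + k))
        (antitone_nat_of_succ_le fun i => by
          have := f.2.diag i (i + k)
          rwa [add_right_comm] at this)
        ⟨c, f.2.2 _ _ (Or.inr (by simp))⟩,
        fun k => fun i => ⟨f.2.succ_right i (i + k), by
          have := f.2.succ_left i (i + k + 1)
          simpa only [DecSeq.ofFun_apply, add_right_comm, ← add_assoc] using this⟩,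
        fun k hk => DecSeq.ext_apply fun i => f.2.2 _ _ (Or.inr (by
          exact_mod_cast hk.trans (Nat.le_add_left k i)))⟩,
      ⟨fun k => DecSeq.ofFun (fun i => f.1 (i + k, i))
        (antitone_nat_of_succ_le fun i => by
          have := f.2.diag (i + k) i
          rwa [add_right_comm] at this)
        ⟨r, f.2.2 _ _ (Or.inl (by simp))⟩,
        fun k => fun i => ⟨f.2.succ_left (i + k) i, by
          have := f.2.succ_right (i + k + 1) i
          simpa only [DecSeq.ofFun_apply, add_right_comm, ← add_assoc] using this⟩,
        fun k hk => DecSeq.ext_apply fun i => f.2.2 _ _ (Or.inl (by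
          exact_mod_cast hk.trans (Nat.le_add_left k i)))⟩), rfl⟩
  invFun p :=
    ⟨Finsupp.onFinset (range r ×ˢ range c) (arrayOfDiagonals p.1.1.1 p.1.2.1) (by
      rintro ⟨i, j⟩ h
      by_contra h'
      refine h (arrayOfDiagonals_eq_zero p i j ?_)
      simp only [mem_product, mem_range] at h'
      omega),
      antitone_arrayOfDiagonals _ _ p.2 p.1.1.2.1 p.1.2.2.1,
      fun i j h => arrayOfDiagonals_eq_zero p i j (by exact_mod_cast h)⟩
  left_inv f := by
    refine Subtype.ext (Finsupp.ext ?_)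
    rintro ⟨i, j⟩
    simp only [Finsupp.onFinset_apply, arrayOfDiagonals]
    split_ifs with h
    · simp [Nat.add_sub_cancel' h]
    · simp [Nat.add_sub_cancel' (not_le.1 h).le]
  right_inv p := by
    refine Subtype.ext (Prod.ext ?_ ?_)
    · refine Subtype.ext (funext fun k => DecSeq.ext_apply fun i => ?_)
      exact arrayOfDiagonals_upper _ _ i k
    · refine Subtype.ext (funext fun k => DecSeq.ext_apply fun i => ?_)
      exact arrayOfDiagonals_lower _ _ p.2 i k

lemma mapDomain_upper_apply (g : ℕ →₀ ℕ) (k i j : ℕ) :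
    g.mapDomain (fun a => (a, a + k)) (i, j) = if j = i + k then g i else 0 := by
  have hinj : Injective fun a : ℕ => (a, a + k) := fun a b h => (Prod.ext_iff.1 h).1
  split_ifs with h
  · rw [h]
    exact Finsupp.mapDomain_apply hinj g i
  · refine Finsupp.mapDomain_of_notMem_range _ _ ?_
    rintro ⟨a, ha⟩
    simp only [Prod.mk.injEq] at ha
    omega

lemma mapDomain_lower_apply (g : ℕ →₀ ℕ) (k i j : ℕ) :
    g.mapDomain (fun a => (a + k, a)) (i, j) = if i = j + k then g j else 0 := by
  have hinj : Injective fun a : ℕ => (a + k, a) := fun a b h => (Prod.ext_iff.1 h).2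
  split_ifs with h
  · rw [h]
    exact Finsupp.mapDomain_apply hinj g j
  · refine Finsupp.mapDomain_of_notMem_range _ _ ?_
    rintro ⟨a, ha⟩
    simp only [Prod.mk.injEq] at ha
    omega

/-- The main diagonal heads both chains but is counted once; hence one top and two tails. The array
is a sum of its diagonals pushed forward into the plane, and `mapDomain` preserves the degree. -/
lemma degree_eq_diagonals (r c : ℕ) (f : {f // IsPlanePartition r c f}) :
    f.1.degree = ((diagonalsEquiv r c f).1.1.1 0).size + (diagonalsEquiv r c f).1.1.tailSize +
      (diagonalsEquiv r c f).1.2.tailSize := by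
  set p := diagonalsEquiv r c f with hp
  have hf : f.1 = (p.1.1.1 0).1.mapDomain (fun a => (a, a + 0)) +
      ∑ k ∈ range c, (p.1.1.1 (k + 1)).1.mapDomain (fun a => (a, a + (k + 1))) +
      ∑ k ∈ range r, (p.1.2.1 (k + 1)).1.mapDomain (fun a => (a + (k + 1), a)) := by
    ext ⟨i, j⟩
    simp only [Finsupp.add_apply, Finsupp.finsetSum_apply, mapDomain_upper_apply,
      mapDomain_lower_apply]
    have hu : ∀ k i, (p.1.1.1 k).1 i = f.1 (i, i + k) := fun k i => rfl
    have hl : ∀ k i, (p.1.2.1 k).1 i = f.1 (i + k, i) := fun k i => rfl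
    simp only [hu, hl]
    have hzero := f.2.2 i j
    simp only [Nat.cast_le] at hzero
    rcases lt_trichotomy i j with h | h | h
    · rw [if_neg (by omega), Finset.sum_eq_zero (s := range r) (fun k _ => if_neg (by omega)),
        zero_add, add_zero]
      obtain ⟨k, rfl⟩ := Nat.exists_eq_add_of_lt h
      rw [Finset.sum_eq_single k (fun b _ hb => if_neg (by omega))
        (fun hk => by
          rw [if_pos (by omega)]
          exact hzero (Or.inr (by simp at hk; omega))), if_pos (by omega)]
      rfl
    · rw [if_pos (by omega), Finset.sum_eq_zero (fun k _ => if_neg (by omega)),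
        Finset.sum_eq_zero (fun k _ => if_neg (by omega)), h]
      rfl
    · rw [if_neg (by omega), Finset.sum_eq_zero (s := range c) (fun k _ => if_neg (by omega)),
        zero_add, zero_add]
      obtain ⟨k, rfl⟩ := Nat.exists_eq_add_of_lt h
      rw [Finset.sum_eq_single k (fun b _ hb => if_neg (by omega))
        (fun hk => by
          rw [if_pos (by omega)]
          exact hzero (Or.inl (by simp at hk; omega))), if_pos (by omega)]
      rfl
  conv_lhs => rw [hf]
  simp only [map_add, map_sum, Finsupp.degree_mapDomain]
  rfl

/-- MacMahon's formula for plane partitions in a rectangle. -/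
lemma tsum_planePartition (x : ENNReal) (hx : x ≠ 0) (hx' : x ≠ ⊤) (r c : ℕ) :
    ∑' f : {f // IsPlanePartition r c f}, x ^ f.1.degree =
      ∏ i ∈ range r, ∏ j ∈ range c, (1 - x ^ (i + j + 1))⁻¹ := by
  classical
  -- Taking `t = x` weighs the common top, the main diagonal, once.
  have h := tsum_chainSum_mul x hx hx' c r x hx hx'
  simp only [← pow_succ'] at h
  rw [← h, ← (diagonalsEquiv r c).symm.tsum_eq]
  have h2 : ∀ p, x ^ ((diagonalsEquiv r c).symm p).1.degree =
      x ^ (p.1.1.1 0).size * x ^ p.1.1.tailSize * x ^ p.1.2.tailSize := by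
    intro p
    rw [degree_eq_diagonals, Equiv.apply_symm_apply, pow_add, pow_add]
  simp only [h2]
  rw [← tsum_ite_zero (fun p : InterlacingChain c × InterlacingChain r => p.1.1 0 = p.2.1 0)
    (fun p => x ^ (p.1.1 0).size * x ^ p.1.tailSize * x ^ p.2.tailSize), ENNReal.tsum_prod']
  simp only [chainSum_eq_tsum, ← ENNReal.tsum_mul_right]
  symm
  rw [ENNReal.tsum_comm]
  refine tsum_congr fun L => ?_
  rw [tsum_eq_single (L.1 0) (fun μ hμ => by simp [hμ.symm]), ← ENNReal.tsum_mul_left]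
  refine tsum_congr fun M => ?_
  by_cases h : M.1 0 = L.1 0
  · simp [h, mul_comm]
  · simp [h, Ne.symm h]

end PlanePartitions

/-! ### Products of finitely many geometric series. -/

noncomputable section GeometricSeries

/-- Exponent vectors supported in `insert i S`, split into the exponent at `i` and the rest. -/
def supportedInsertEquiv {ι : Type*} [DecidableEq ι] (i : ι) (S : Finset ι) (hi : i ∉ S) :
    {a : ι →₀ ℕ // a.support ⊆ insert i S} ≃ ℕ × {a : ι →₀ ℕ // a.support ⊆ S} where
  toFun a := (a.1 i, ⟨a.1.erase i, by
    rw [Finsupp.support_erase]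
    exact (Finset.erase_subset_erase i a.2).trans (Finset.erase_insert hi).subset⟩)
  invFun p := ⟨p.2.1.update i p.1, by
    refine (Finsupp.support_update_subset _ _).trans ?_
    exact Finset.insert_subset_insert i p.2.2⟩
  left_inv a := by
    refine Subtype.ext (Finsupp.ext fun j => ?_)
    by_cases h : j = i <;> simp [h]
  right_inv p := by
    have h0 : p.2.1 i = 0 := Finsupp.notMem_support_iff.1 fun h => hi (p.2.2 h)
    refine Prod.ext (by simp) (Subtype.ext (Finsupp.ext fun j => ?_))
    by_cases h : j = i
    · simp [h, h0]
    · simp [h]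

lemma prod_supportedInsertEquiv {ι M : Type*} [CommMonoid M] [DecidableEq ι] (i : ι)
    (S : Finset ι) (hi : i ∉ S) (z : ι → M) (p : ℕ × {a : ι →₀ ℕ // a.support ⊆ S}) :
    ((supportedInsertEquiv i S hi).symm p).1.prod (fun j n => z j ^ n) =
      z i ^ p.1 * p.2.1.prod (fun j n => z j ^ n) := by
  have h0 : p.2.1 i = 0 := Finsupp.notMem_support_iff.1 fun h => hi (p.2.2 h)
  rw [Finsupp.prod_of_support_subset _ ((supportedInsertEquiv i S hi).symm p).2 _ (by simp),
    Finsupp.prod_of_support_subset _ p.2.2 _ (by simp), Finset.prod_insert hi]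
  congr 1
  · simp [supportedInsertEquiv]
  · refine Finset.prod_congr rfl fun j hj => ?_
    have : j ≠ i := fun h => hi (h ▸ hj)
    simp [supportedInsertEquiv, Function.update_of_ne this]

instance uniqueSupportedEmpty {ι : Type*} : Unique {a : ι →₀ ℕ // a.support ⊆ (∅ : Finset ι)} where
  default := ⟨0, by simp⟩
  uniq a := Subtype.ext (Finsupp.support_eq_empty.1 (Finset.subset_empty.1 a.2))

/-- No bound on `z` is needed: for a ratio at least `1`, truncated subtraction makes `(1 - z i)⁻¹`
infinite, as is the series. -/
lemma ENNReal.tsum_finsupp_geometric {ι : Type*} (z : ι → ENNReal) (S : Finset ι) :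
    ∑' a : {a : ι →₀ ℕ // a.support ⊆ S}, a.1.prod (fun i n => z i ^ n) =
      ∏ i ∈ S, (1 - z i)⁻¹ := by
  classical
  induction S using Finset.induction_on with
  | empty =>
    rw [tsum_eq_single default (fun b hb => (hb (Unique.eq_default b)).elim)]
    simp [default]
  | insert i S hi ih =>
    rw [← (supportedInsertEquiv i S hi).symm.tsum_eq, ENNReal.tsum_prod']
    simp only [prod_supportedInsertEquiv, ENNReal.tsum_mul_left, ih, ENNReal.tsum_mul_right,
      ENNReal.tsum_geometric]
    rw [Finset.prod_insert hi]

lemma hasSum_mul_of_summable_norm {𝕜 ι κ : Type*} [NormedField 𝕜] [CompleteSpace 𝕜]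
    {f : ι → 𝕜} {g : κ → 𝕜} {s t : 𝕜}
    (hf : Summable fun i => ‖f i‖) (hg : Summable fun k => ‖g k‖) (hfs : HasSum f s)
    (hgt : HasSum g t) :
    (Summable fun p : ι × κ => ‖f p.1 * g p.2‖) ∧
      HasSum (fun p : ι × κ => f p.1 * g p.2) (s * t) :=
  ⟨hf.mul_norm hg, hfs.mul hgt (summable_mul_of_summable_norm hf hg)⟩

lemma hasSum_finsupp_geometric_finset {𝕜 ι : Type*} [NormedField 𝕜] [CompleteSpace 𝕜]
    (z : ι → 𝕜) (S : Finset ι)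
    (hz : ∀ i, ‖z i‖ < 1) :
    (Summable fun a : {a : ι →₀ ℕ // a.support ⊆ S} => ‖a.1.prod (fun i n => z i ^ n)‖) ∧
    HasSum (fun a : {a : ι →₀ ℕ // a.support ⊆ S} => a.1.prod (fun i n => z i ^ n))
      (∏ i ∈ S, (1 - z i)⁻¹) := by
  classical
  induction S using Finset.induction_on with
  | empty =>
    refine ⟨(hasSum_unique _).summable, ?_⟩
    have h := hasSum_unique fun a : {a : ι →₀ ℕ // a.support ⊆ (∅ : Finset ι)} =>
      a.1.prod (fun i n => z i ^ n)
    rwa [show (default : {a : ι →₀ ℕ // a.support ⊆ (∅ : Finset ι)}).1.prod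
      (fun i n => z i ^ n) = 1 from Finsupp.prod_zero_index] at h
  | insert i S hi ih =>
    have hg : Summable fun n : ℕ => ‖z i ^ n‖ := by
      simpa only [norm_pow] using summable_geometric_of_lt_one (norm_nonneg _) (hz i)
    rw [← (supportedInsertEquiv i S hi).symm.summable_iff,
      ← (supportedInsertEquiv i S hi).symm.hasSum_iff]
    simp only [Function.comp_def, prod_supportedInsertEquiv]
    rw [Finset.prod_insert hi]
    exact hasSum_mul_of_summable_norm (f := fun n => z i ^ n)
      (g := fun a : {a : ι →₀ ℕ // a.support ⊆ S} => a.1.prod (fun i n => z i ^ n))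
      hg ih.1 (hasSum_geometric_of_norm_lt_one (hz i)) ih.2

end GeometricSeries

/-! ### Coefficients from values of power series. -/

section PowerSeriesUniqueness

/-- Let `x` tend to `0` along powers of `1 / 2`: the series of `β` is at most `β 0 + x * M`, with
`M` the finite value of the shifted series at `1 / 2`. -/
lemma ENNReal.coeff_zero_le_of_forall_tsum_eq {α β : ℕ → ENNReal}
    (h : ∀ x : ENNReal, x ≠ 0 → x < 1 → ∑' n, α n * x ^ n = ∑' n, β n * x ^ n)
    (hb : ∀ x : ENNReal, x ≠ 0 → x < 1 → ∑' n, β n * x ^ n ≠ ⊤) : α 0 ≤ β 0 := by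
  have h2 : (2⁻¹ : ENNReal) ≠ 0 := by simp
  have h2' : (2⁻¹ : ENNReal) < 1 := ENNReal.inv_lt_one.2 (by norm_num)
  have hshift : ∀ x : ENNReal, ∑' n, β n * x ^ n = β 0 + x * ∑' n, β (n + 1) * x ^ n := by
    intro x
    rw [tsum_eq_zero_add' ENNReal.summable, ← ENNReal.tsum_mul_left]
    simp only [pow_zero, mul_one, pow_succ']
    congr 1
    exact tsum_congr fun n => by ring
  set M := ∑' n, β (n + 1) * (2⁻¹ : ENNReal) ^ n with hM
  have hMtop : M ≠ ⊤ := by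
    intro hMt
    refine hb _ h2 h2' ?_
    rw [hshift, ← hM, hMt, ENNReal.mul_top h2, add_top]
  have hle : ∀ m : ℕ, α 0 ≤ β 0 + (2⁻¹ : ENNReal) ^ (m + 1) * M := by
    intro m
    have hx : (2⁻¹ : ENNReal) ^ (m + 1) ≠ 0 := pow_ne_zero _ h2
    have hx2 : (2⁻¹ : ENNReal) ^ (m + 1) ≤ 2⁻¹ := by
      rw [pow_succ]
      exact mul_le_of_le_one_left' (pow_le_one' h2'.le m)
    calc α 0 = α 0 * ((2⁻¹ : ENNReal) ^ (m + 1)) ^ 0 := by simp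
      _ ≤ ∑' n, α n * ((2⁻¹ : ENNReal) ^ (m + 1)) ^ n := ENNReal.le_tsum 0
      _ = ∑' n, β n * ((2⁻¹ : ENNReal) ^ (m + 1)) ^ n := h _ hx (hx2.trans_lt h2')
      _ = _ := hshift _
      _ ≤ _ := by
        gcongr
        exact ENNReal.tsum_le_tsum fun n => by gcongr
  have hlim : Filter.Tendsto (fun m : ℕ => β 0 + (2⁻¹ : ENNReal) ^ (m + 1) * M) Filter.atTop
      (nhds (β 0 + 0 * M)) := by
    refine Filter.Tendsto.const_add _ (ENNReal.Tendsto.mul_const ?_ (Or.inr hMtop))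
    exact (ENNReal.tendsto_pow_atTop_nhds_zero_of_lt_one h2').comp (Filter.tendsto_add_atTop_nat 1)
  simpa using ge_of_tendsto' hlim hle

/-- Compare constant terms, cancel them and divide by `x`; then induct on the index with the shifted
sequences. Finiteness is what permits the cancellation. -/
lemma ENNReal.coeff_eq_of_forall_tsum_eq (n : ℕ) : ∀ {α β : ℕ → ENNReal}
    (_ : ∀ x : ENNReal, x ≠ 0 → x < 1 → ∑' n, α n * x ^ n = ∑' n, β n * x ^ n)
    (_ : ∀ x : ENNReal, x ≠ 0 → x < 1 → ∑' n, β n * x ^ n ≠ ⊤), α n = β n := by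
  have hshift : ∀ (γ : ℕ → ENNReal) (x : ENNReal),
      ∑' n, γ n * x ^ n = γ 0 + x * ∑' n, γ (n + 1) * x ^ n := by
    intro γ x
    rw [tsum_eq_zero_add' ENNReal.summable, ← ENNReal.tsum_mul_left]
    simp only [pow_zero, mul_one, pow_succ']
    congr 1
    exact tsum_congr fun n => by ring
  have hzero : ∀ {α β : ℕ → ENNReal}
      (_ : ∀ x : ENNReal, x ≠ 0 → x < 1 → ∑' n, α n * x ^ n = ∑' n, β n * x ^ n)
      (_ : ∀ x : ENNReal, x ≠ 0 → x < 1 → ∑' n, β n * x ^ n ≠ ⊤), α 0 = β 0 :=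
    fun h hb => le_antisymm (coeff_zero_le_of_forall_tsum_eq h hb)
      (coeff_zero_le_of_forall_tsum_eq (fun x hx hx' => (h x hx hx').symm)
        fun x hx hx' => by rw [h x hx hx']; exact hb x hx hx')
  induction n with
  | zero => exact hzero
  | succ n ih =>
    intro α β h hb
    refine ih (α := fun n => α (n + 1)) (β := fun n => β (n + 1)) (fun x hx hx' => ?_)
      (fun x hx hx' ht => ?_)
    · have h1 := h x hx hx'
      have h2 := hb x hx hx'
      rw [hshift α, hshift β, hzero h hb] at h1
      have h3 : β 0 ≠ ⊤ := fun ht => h2 (by rw [hshift, ht, top_add])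
      exact (ENNReal.mul_right_inj hx (hx'.trans ENNReal.one_lt_top).ne).1
        ((ENNReal.add_right_inj h3).1 h1)
    · refine hb x hx hx' ?_
      rw [hshift, ht, ENNReal.mul_top hx, add_top]

lemma tsum_pow_eq_tsum_card_fiber {C : Type*} (u : C → ℕ) (x : ENNReal) :
    ∑' c, x ^ u c = ∑' n, (ENat.card {c // u c = n} : ENNReal) * x ^ n := by
  rw [← (Equiv.sigmaFiberEquiv u).tsum_eq, ENNReal.tsum_sigma']
  refine tsum_congr fun n => ?_
  rw [← ENNReal.tsum_const]
  exact tsum_congr fun c => congrArg (x ^ ·) c.2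

/-- Weighted types with equal finite generating functions have equinumerous fibres. -/
lemma nonempty_fiber_equiv_of_tsum_eq {A B : Type*} (v : A → ℕ) (w : B → ℕ)
    (h : ∀ x : ENNReal, x ≠ 0 → x < 1 → ∑' a, x ^ v a = ∑' b, x ^ w b)
    (hb : ∀ x : ENNReal, x ≠ 0 → x < 1 → ∑' b, x ^ w b ≠ ⊤) (n : ℕ) :
    Nonempty ({a // v a = n} ≃ {b // w b = n}) := by
  have heq : (ENat.card {a // v a = n} : ENNReal) = ENat.card {b // w b = n} :=
    ENNReal.coeff_eq_of_forall_tsum_eq n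
      (α := fun n => (ENat.card {a // v a = n} : ENNReal))
      (β := fun n => (ENat.card {b // w b = n} : ENNReal))
      (fun x hx hx' => by rw [← tsum_pow_eq_tsum_card_fiber, ← tsum_pow_eq_tsum_card_fiber, h x hx hx'])
      (fun x hx hx' => by rw [← tsum_pow_eq_tsum_card_fiber]; exact hb x hx hx')
  have h2 : (2⁻¹ : ENNReal) ≠ 0 := by simp
  have h2' : (2⁻¹ : ENNReal) < 1 := ENNReal.inv_lt_one.2 (by norm_num)
  -- An infinite fibre would make the generating function infinite at `1 / 2`.
  have hfin : (ENat.card {b // w b = n} : ENNReal) ≠ ⊤ := by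
    intro ht
    refine hb _ h2 h2' ?_
    rw [tsum_pow_eq_tsum_card_fiber]
    refine ENNReal.tsum_eq_top_of_eq_top ⟨n, ?_⟩
    rw [ht, ENNReal.top_mul (pow_ne_zero _ h2)]
  have heq' : ENat.card {a // v a = n} = ENat.card {b // w b = n} := by exact_mod_cast heq
  have hfB : Finite {b // w b = n} := by
    by_contra hinf
    rw [not_finite_iff_infinite] at hinf
    exact hfin (by rw [ENat.card_eq_top_of_infinite]; rfl)
  have hfA : Finite {a // v a = n} := by
    by_contra hinf
    rw [not_finite_iff_infinite] at hinf
    rw [ENat.card_eq_top_of_infinite, eq_comm, ENat.card_eq_top] at heq'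
    exact not_finite_iff_infinite.2 heq' hfB
  rw [ENat.card_eq_coe_natCard, ENat.card_eq_coe_natCard] at heq'
  exact Finite.card_eq.1 (by exact_mod_cast heq')

end PowerSeriesUniqueness

/-! ### MacMahon's theorem with an unbounded number of columns. -/

noncomputable section MacMahon

/-- Plane partitions with at most `r` rows. -/
abbrev PlanePartition (r : ℕ∞) : Type := {f : ℕ × ℕ →₀ ℕ // IsPlanePartition r ⊤ f}

instance (r : ℕ∞) : Zero (PlanePartition r) := ⟨⟨0, fun _ _ _ => le_rfl, fun _ _ _ => rfl⟩⟩

/-- The cells `(i, j)` in the first `r` rows. -/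
abbrev RowCell (r : ℕ∞) : Type := {c : ℕ × ℕ // (c.1 : ℕ∞) < r}

/-- The hook length of a cell of a large rectangle, counted from the opposite corner. -/
def RowCell.hook {r : ℕ∞} (c : RowCell r) : ℕ := c.1.1 + c.1.2 + 1

/-- The weight of an array in which the cell `c` counts `c.hook` times. -/
def hookWeight {r : ℕ∞} (a : RowCell r →₀ ℕ) : ℕ := a.sum fun c v => c.hook * v

lemma pow_hookWeight {M : Type*} [CommMonoid M] {r : ℕ∞} (x : M) (a : RowCell r →₀ ℕ) :
    x ^ hookWeight a = a.prod fun c v => (x ^ c.hook) ^ v := by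
  simp only [hookWeight, Finsupp.sum, Finsupp.prod, ← pow_mul, Finset.prod_pow_eq_pow_sum]

lemma hook_le_hookWeight {r : ℕ∞} (a : RowCell r →₀ ℕ) {c : RowCell r} (hc : c ∈ a.support) :
    c.hook ≤ hookWeight a := by
  refine le_trans ?_ (Finset.single_le_sum (f := fun c => c.hook * a c)
    (fun _ _ => Nat.zero_le _) hc)
  exact Nat.le_mul_of_pos_right _ (Nat.pos_of_ne_zero (Finsupp.mem_support_iff.1 hc))

lemma coe_minExponent (m : ℕ) (r : ℕ∞) : (minExponent m r : ℕ∞) = min (m : ℕ∞) r :=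
  ENat.natCast_toNat (ne_top_of_le_ne_top (ENat.natCast_ne_top m) (min_le_left _ _))

/-- The source of the exponent: a cell with `hook` equal to `m` is determined by its row `i`,
subject to `i < m` and `i < r`. -/
lemma lt_minExponent {i m : ℕ} {r : ℕ∞} : i < minExponent m r ↔ i < m ∧ (i : ℕ∞) < r := by
  rw [← Nat.cast_lt (α := ℕ∞), coe_minExponent, lt_min_iff, Nat.cast_lt]

/-- The cells in the first `r` rows, the first `n` rows and the first `n` columns. -/
def boxCells (r : ℕ∞) (n : ℕ) : Finset (RowCell r) :=
  (range (minExponent n r) ×ˢ range n).subtype _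

lemma prod_boxCells {M : Type*} [CommMonoid M] (r : ℕ∞) (n : ℕ) (g : ℕ → M) :
    ∏ c ∈ boxCells r n, g c.hook = ∏ i ∈ range (minExponent n r), ∏ j ∈ range n, g (i + j + 1) := by
  rw [← Finset.prod_product', boxCells]
  refine Finset.prod_subtype_of_mem (fun c : ℕ × ℕ => g (c.1 + c.2 + 1)) fun c hc => ?_
  exact (lt_minExponent.1 (mem_range.1 (mem_product.1 hc).1)).2

lemma card_le_degree {α : Type*} (f : α →₀ ℕ) (s : Finset α) (hs : ∀ a ∈ s, f a ≠ 0) :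
    s.card ≤ f.degree := by
  calc s.card ≤ f.support.card :=
        Finset.card_le_card fun a ha => Finsupp.mem_support_iff.2 (hs a ha)
    _ = ∑ a ∈ f.support, 1 := by simp
    _ ≤ f.degree := Finset.sum_le_sum fun a ha =>
        Nat.one_le_iff_ne_zero.2 (Finsupp.mem_support_iff.1 ha)

/-- A nonzero entry forces all entries above it in its column and before it in its row to be
nonzero, and each adds at least `1` to the degree. -/
lemma IsPlanePartition.lt_degree {r c : ℕ∞} {f : ℕ × ℕ →₀ ℕ} (h : IsPlanePartition r c f)
    {i j : ℕ} (hij : f (i, j) ≠ 0) : i < f.degree ∧ j < f.degree := by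
  constructor
  · have := card_le_degree f ((range (i + 1)).map ⟨fun k => (k, j), Prod.mk_left_injective j⟩) (by
      intro a ha
      obtain ⟨k, hk, rfl⟩ := Finset.mem_map.1 ha
      have := h.1 (show ((k, j) : ℕ × ℕ) ≤ (i, j) from ⟨by simpa [Nat.lt_succ_iff] using hk, le_rfl⟩)
      change f (k, j) ≠ 0
      omega)
    rw [card_map, card_range] at this
    omega
  · have := card_le_degree f ((range (j + 1)).map ⟨fun k => (i, k), Prod.mk_right_injective i⟩) (by
      intro a ha
      obtain ⟨k, hk, rfl⟩ := Finset.mem_map.1 ha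
      have := h.1 (show ((i, k) : ℕ × ℕ) ≤ (i, j) from ⟨le_rfl, by simpa [Nat.lt_succ_iff] using hk⟩)
      change f (i, k) ≠ 0
      omega)
    rw [card_map, card_range] at this
    omega

lemma isPlanePartition_box_iff {r : ℕ∞} {n : ℕ} {f : ℕ × ℕ →₀ ℕ} (hn : f.degree = n) :
    IsPlanePartition (minExponent n r) n f ↔ IsPlanePartition r ⊤ f := by
  constructor
  · refine fun h => ⟨h.1, fun i j hij => h.2 i j (Or.inl ?_)⟩
    rw [coe_minExponent]
    exact (min_le_right _ _).trans (hij.resolve_right (by simp))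
  · refine fun h => ⟨h.1, fun i j hij => ?_⟩
    by_contra hne
    have := h.lt_degree hne
    rw [coe_minExponent, min_le_iff, Nat.cast_le, Nat.cast_le] at hij
    rcases hij with (hi | hi) | hj
    · omega
    · exact hne (h.2 i j (Or.inl hi))
    · omega

lemma support_subset_boxCells {r : ℕ∞} (a : RowCell r →₀ ℕ) :
    a.support ⊆ boxCells r (hookWeight a) := by
  intro c hc
  have h := hook_le_hookWeight a hc
  rw [RowCell.hook] at h
  simp only [boxCells, mem_subtype, mem_product, mem_range, lt_minExponent]
  exact ⟨⟨by omega, c.2⟩, by omega⟩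

/-- In size `n` nothing on either side leaves the first `n` rows and columns, so MacMahon's formula
for a finite box depending on `n` suffices. -/
lemma nonempty_planePartition_fiber_equiv (r : ℕ∞) (n : ℕ) :
    Nonempty ({f : PlanePartition r // f.1.degree = n} ≃
      {a : RowCell r →₀ ℕ // hookWeight a = n}) := by
  obtain ⟨e⟩ := nonempty_fiber_equiv_of_tsum_eq
    (fun f : {f // IsPlanePartition (minExponent n r : ℕ) (n : ℕ) f} => f.1.degree)
    (fun a : {a : RowCell r →₀ ℕ // a.support ⊆ boxCells r n} => hookWeight a.1)
    (fun x hx hx' => by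
      simp only [pow_hookWeight]
      rw [tsum_planePartition x hx (hx'.trans ENNReal.one_lt_top).ne,
        ENNReal.tsum_finsupp_geometric (fun c : RowCell r => x ^ c.hook),
        prod_boxCells r n (fun k => (1 - x ^ k)⁻¹)])
    (fun x hx hx' => by
      simp only [pow_hookWeight]
      rw [ENNReal.tsum_finsupp_geometric (fun c : RowCell r => x ^ c.hook)]
      refine ENNReal.prod_ne_top fun c _ => ENNReal.inv_ne_top.2 ?_
      exact (tsub_pos_of_lt (pow_lt_one₀ zero_le hx' (by simp [RowCell.hook]))).ne') n
  have e1 : {f : PlanePartition r // f.1.degree = n} ≃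
      {f : {f // IsPlanePartition (minExponent n r : ℕ) (n : ℕ) f} // f.1.degree = n} :=
    { toFun := fun f => ⟨⟨f.1.1, (isPlanePartition_box_iff f.2).2 f.1.2⟩, f.2⟩
      invFun := fun f => ⟨⟨f.1.1, (isPlanePartition_box_iff f.2).1 f.1.2⟩, f.2⟩
      left_inv := fun f => rfl
      right_inv := fun f => rfl }
  have e2 : {a : {a : RowCell r →₀ ℕ // a.support ⊆ boxCells r n} // hookWeight a.1 = n} ≃
      {a : RowCell r →₀ ℕ // hookWeight a = n} :=
    { toFun := fun a => ⟨a.1.1, a.2⟩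
      invFun := fun a => ⟨⟨a.1, by
        have h := support_subset_boxCells a.1
        rwa [a.2] at h⟩, a.2⟩
      left_inv := fun f => rfl
      right_inv := fun f => rfl }
  exact ⟨(e1.trans e).trans e2⟩

/-- **MacMahon's theorem**: plane partitions with at most `r` rows are equinumerous with arrays
in the first `r` rows weighted by hook lengths. -/
theorem exists_planePartition_equiv (r : ℕ∞) :
    ∃ e : PlanePartition r ≃ (RowCell r →₀ ℕ), ∀ f, hookWeight (e f) = f.1.degree := by
  -- The bijection is not canonical: it is chosen separately in each degree and glued.
  let e n := (nonempty_planePartition_fiber_equiv r n).some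
  refine ⟨(Equiv.sigmaFiberEquiv _).symm.trans
    ((Equiv.sigmaCongrRight e).trans (Equiv.sigmaFiberEquiv _)), fun f => ?_⟩
  exact (e f.1.degree ⟨f, rfl⟩).2

end MacMahon

/-! ### Torsion ranks as a complete invariant of finite Abelian groups. -/

section TorsionRank

/-- The `𝔽_p`-dimension of the `p`-torsion of `p ^ i A`. -/
noncomputable def torsionRank (A : Type*) [AddCommGroup A] (p i : ℕ) : ℕ :=
  Nat.log p (Nat.card {x : A // p • x = 0 ∧ ∃ y : A, x = p ^ i • y})

lemma torsionRank_le_of_injective {A B : Type*} [AddCommGroup A] [AddCommGroup B] [Finite B]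
    (f : A →+ B) (hf : Injective f) (p i : ℕ) : torsionRank A p i ≤ torsionRank B p i := by
  refine Nat.log_mono_right (Nat.card_le_card_of_injective
    (fun x : {x : A // p • x = 0 ∧ ∃ y : A, x = p ^ i • y} => (⟨f x.1, by
      obtain ⟨x, hx, y, rfl⟩ := x
      exact ⟨by rw [← map_nsmul, hx, map_zero], f y, by rw [map_nsmul]⟩⟩ :
        {x : B // p • x = 0 ∧ ∃ y : B, x = p ^ i • y})) fun x y h => ?_)
  exact Subtype.ext (hf (Subtype.ext_iff.1 h))

lemma torsionRank_congr {A B : Type*} [AddCommGroup A] [AddCommGroup B] [Finite A] [Finite B]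
    (e : A ≃+ B) (p i : ℕ) : torsionRank A p i = torsionRank B p i :=
  le_antisymm (torsionRank_le_of_injective e.toAddMonoidHom e.injective p i)
    (torsionRank_le_of_injective e.symm.toAddMonoidHom e.symm.injective p i)

/-- For `q ≠ p`, multiplication by `p` is invertible. For `q = p` and `e > 0`, the `p`-torsion is
generated by `p ^ (e - 1)`, which is a multiple of `p ^ i` exactly when it survives for `i < e`. -/
lemma card_torsion_zmod (p q : Nat.Primes) (i e : ℕ) :
    Nat.card {x : ZMod ((q : ℕ) ^ e) // (p : ℕ) • x = 0 ∧ ∃ y, x = (p : ℕ) ^ i • y} =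
      if q = p ∧ i < e then (p : ℕ) else 1 := by
  have hone : (∀ x : ZMod ((q : ℕ) ^ e), (p : ℕ) • x = 0 ∧ (∃ y, x = (p : ℕ) ^ i • y) → x = 0) →
      Nat.card {x : ZMod ((q : ℕ) ^ e) // (p : ℕ) • x = 0 ∧ ∃ y, x = (p : ℕ) ^ i • y} = 1 := by
    intro h
    rw [Nat.card_eq_one_iff_unique]
    exact ⟨⟨fun x y => Subtype.ext ((h _ x.2).trans (h _ y.2).symm)⟩, ⟨⟨0, by simp, 0, by simp⟩⟩⟩
  by_cases hqp : q = p
  · subst hqp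
    by_cases hie : i < e
    · rw [if_pos ⟨rfl, hie⟩]
      obtain ⟨d, rfl⟩ : ∃ d, e = d + 1 := ⟨e - 1, by omega⟩
      have hq := q.2.pos
      have : NeZero ((q : ℕ) ^ (d + 1)) := ⟨(pow_pos hq _).ne'⟩
      let φ : Fin q → {x : ZMod ((q : ℕ) ^ (d + 1)) //
          (q : ℕ) • x = 0 ∧ ∃ y, x = (q : ℕ) ^ i • y} := fun j =>
        ⟨((q ^ d * j : ℕ) : ZMod ((q : ℕ) ^ (d + 1))), by
          rw [nsmul_eq_mul, ← Nat.cast_mul, ZMod.natCast_eq_zero_iff, ← mul_assoc, ← pow_succ']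
          exact dvd_mul_right _ _, ((q ^ (d - i) * j : ℕ) : ZMod ((q : ℕ) ^ (d + 1))), by
          rw [nsmul_eq_mul, ← Nat.cast_mul, ← mul_assoc, ← pow_add,
            Nat.add_sub_cancel' (Nat.lt_succ_iff.1 hie)]⟩
      have hφ : Bijective φ := by
        constructor
        · intro j j' h
          have h1 := Subtype.ext_iff.1 h
          have hlt : ∀ j : Fin q, (q : ℕ) ^ d * j < (q : ℕ) ^ (d + 1) := fun j => by
            rw [pow_succ]
            exact Nat.mul_lt_mul_of_pos_left j.2 (pow_pos hq _)
          simp only [φ] at h1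
          rw [ZMod.natCast_eq_natCast_iff, Nat.ModEq, Nat.mod_eq_of_lt (hlt j),
            Nat.mod_eq_of_lt (hlt j')] at h1
          exact Fin.ext (Nat.eq_of_mul_eq_mul_left (pow_pos hq _) h1)
        · rintro ⟨x, hx, hy⟩
          obtain ⟨n, rfl⟩ := ZMod.natCast_zmod_surjective x
          rw [nsmul_eq_mul, ← Nat.cast_mul, ZMod.natCast_eq_zero_iff, pow_succ'] at hx
          obtain ⟨m, rfl⟩ := Nat.dvd_of_mul_dvd_mul_left hq hx
          refine ⟨⟨m % q, Nat.mod_lt _ hq⟩, Subtype.ext ?_⟩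
          simp only [φ]
          rw [ZMod.natCast_eq_natCast_iff, pow_succ]
          exact Nat.ModEq.mul_left' _ (Nat.mod_modEq _ _)
      rw [← Nat.card_congr (Equiv.ofBijective φ hφ), Nat.card_fin]
    · rw [if_neg (fun h => hie h.2)]
      refine hone fun x hx => ?_
      obtain ⟨-, y, rfl⟩ := hx
      rw [nsmul_eq_mul]
      have : (((q : ℕ) ^ i : ℕ) : ZMod ((q : ℕ) ^ e)) = 0 := by
        rw [ZMod.natCast_eq_zero_iff]
        exact pow_dvd_pow _ (not_lt.1 hie)
      rw [this, zero_mul]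
  · rw [if_neg (fun h => hqp h.1)]
    refine hone fun x hx => ?_
    have hcop : Nat.Coprime (p : ℕ) ((q : ℕ) ^ e) :=
      ((Nat.coprime_primes p.2 q.2).2 fun h => hqp (Subtype.ext h.symm)).pow_right e
    have hu := (ZMod.isUnit_iff_coprime _ _).2 hcop
    rw [nsmul_eq_mul] at hx
    exact (hu.mul_right_eq_zero).1 hx.1

variable {K : Type*} [Fintype K]

instance (q : K → Nat.Primes) (e : K → ℕ) (k : K) : NeZero ((q k : ℕ) ^ e k) :=
  ⟨(pow_pos (q k).2.pos _).ne'⟩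

/-- The torsion is computed factorwise and each relevant cyclic factor contributes one factor `p`.
Thus the ranks form the conjugate of the partition of exponents at `p`. -/
lemma torsionRank_pi_zmod (q : K → Nat.Primes) (e : K → ℕ) (p : Nat.Primes) (i : ℕ) :
    torsionRank (∀ k, ZMod ((q k : ℕ) ^ e k)) p i =
      (univ.filter fun k => q k = p ∧ i < e k).card := by
  classical
  have h1 : Nat.card {x : ∀ k, ZMod ((q k : ℕ) ^ e k) //
      (p : ℕ) • x = 0 ∧ ∃ y, x = (p : ℕ) ^ i • y} =
      ∏ k, Nat.card {x : ZMod ((q k : ℕ) ^ e k) // (p : ℕ) • x = 0 ∧ ∃ y, x = (p : ℕ) ^ i • y} := by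
    rw [← Nat.card_pi]
    refine Nat.card_congr ((Equiv.subtypeEquivRight fun x => ?_).trans
      (Equiv.subtypePiEquivPi
        (p := fun k (x : ZMod ((q k : ℕ) ^ e k)) => (p : ℕ) • x = 0 ∧ ∃ y, x = (p : ℕ) ^ i • y)))
    constructor
    · rintro ⟨h, y, hy⟩ k
      exact ⟨congrFun h k, y k, congrFun hy k⟩
    · intro h
      choose h y hy using h
      exact ⟨funext h, y, funext hy⟩
  rw [torsionRank, h1]
  simp only [card_torsion_zmod]
  rw [Finset.prod_ite, Finset.prod_const, Finset.prod_const_one, mul_one,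
    Nat.log_pow p.2.one_lt]

/-- A finite Abelian group is a product of cyclic groups of prime power order. -/
lemma exists_addEquiv_pi_zmod (A : Type*) [AddCommGroup A] [Finite A] :
    ∃ (K : Type) (_ : Fintype K) (q : K → Nat.Primes) (e : K → ℕ),
      Nonempty (A ≃+ ∀ k, ZMod ((q k : ℕ) ^ e k)) := by
  obtain ⟨K, hK, q, hq, e, ⟨f⟩⟩ := AddCommGroup.equiv_directSum_zmod_of_finite A
  exact ⟨K, hK, fun k => ⟨q k, hq k⟩, e, ⟨f.trans (DirectSum.addEquivProd _)⟩⟩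

/-- Hall's marriage theorem. Within one prime the member of `s` with least exponent admits the most
partners, and the counting hypothesis at that exponent minus one supplies enough of them. -/
lemma exists_injective_of_card_le {K' : Type*} [Fintype K'] (q : K → Nat.Primes) (e : K → ℕ)
    (he : ∀ k, 0 < e k) (q' : K' → Nat.Primes) (e' : K' → ℕ)
    (h : ∀ p i, (univ.filter fun k => q k = p ∧ i < e k).card ≤
      (univ.filter fun k => q' k = p ∧ i < e' k).card) :
    ∃ φ : K → K', Injective φ ∧ ∀ k, q' (φ k) = q k ∧ e k ≤ e' (φ k) := by
  classical
  obtain ⟨φ, hφ, hφ'⟩ := (Finset.all_card_le_biUnion_card_iff_exists_injective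
    (fun k => univ.filter fun k' => q' k' = q k ∧ e k ≤ e' k')).1 (by
    intro s
    have h1 := Finset.card_eq_sum_card_fiberwise (f := q) (s := s) (t := s.image q)
      (fun k hk => Finset.mem_image_of_mem q hk)
    rw [h1, Finset.card_eq_sum_card_fiberwise (f := q') (t := s.image q) (fun k' hk' => by
      obtain ⟨k, hk, hk''⟩ := Finset.mem_biUnion.1 hk'
      rw [(Finset.mem_filter.1 hk'').2.1]
      exact Finset.mem_image_of_mem q hk)]
    refine Finset.sum_le_sum fun p hp => ?_
    have hne : (s.filter fun k => q k = p).Nonempty := by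
      obtain ⟨k, hk, rfl⟩ := Finset.mem_image.1 hp
      exact ⟨k, Finset.mem_filter.2 ⟨hk, rfl⟩⟩
    obtain ⟨k₀, hk₀, hmin⟩ := Finset.exists_min_image _ e hne
    rw [Finset.mem_filter] at hk₀
    have hpos := he k₀
    calc (s.filter fun k => q k = p).card
        ≤ (univ.filter fun k => q k = p ∧ e k₀ - 1 < e k).card := by
          refine Finset.card_le_card fun k hk => ?_
          have h2 := hmin k hk
          rw [Finset.mem_filter] at hk ⊢
          exact ⟨mem_univ _, hk.2, by omega⟩
      _ ≤ (univ.filter fun k => q' k = p ∧ e k₀ - 1 < e' k).card := h p _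
      _ ≤ _ := by
          refine Finset.card_le_card fun k' hk' => ?_
          rw [Finset.mem_filter] at hk' ⊢
          refine ⟨Finset.mem_biUnion.2 ⟨k₀, hk₀.1, Finset.mem_filter.2 ⟨mem_univ _, ?_, ?_⟩⟩,
            hk'.2.1⟩
          · rw [hk'.2.1, hk₀.2]
          · omega)
  exact ⟨φ, hφ, fun k => by simpa using hφ' k⟩

lemma exists_injective_zmod (n m : ℕ) (hm : m ≠ 0) :
    ∃ f : ZMod n →+ ZMod (n * m), Injective f := by
  refine ⟨ZMod.lift n ⟨(AddMonoidHom.mulRight (m : ZMod (n * m))).comp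
    (Int.castAddHom (ZMod (n * m))), ?_⟩, ?_⟩
  · have : ((n * m : ℕ) : ZMod (n * m)) = 0 := ZMod.natCast_self _
    rw [Nat.cast_mul] at this
    simpa only [AddMonoidHom.comp_apply, Int.coe_castAddHom, AddMonoidHom.coe_mulRight,
      Int.cast_natCast] using this
  · rw [ZMod.lift_injective]
    intro z hz
    simp only [AddMonoidHom.comp_apply, Int.coe_castAddHom, AddMonoidHom.coe_mulRight] at hz
    have h2 : ((z * m : ℤ) : ZMod (n * m)) = 0 := by push_cast; exact hz
    rw [ZMod.intCast_zmod_eq_zero_iff_dvd] at h2 ⊢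
    push_cast at h2
    exact Int.dvd_of_mul_dvd_mul_right (by exact_mod_cast hm) h2

lemma exists_injective_pi_zmod {K' : Type*} [Fintype K'] (q : K → Nat.Primes) (e : K → ℕ)
    (q' : K' → Nat.Primes) (e' : K' → ℕ)
    (h : ∀ p i, (univ.filter fun k => q k = p ∧ i < e k).card ≤
      (univ.filter fun k => q' k = p ∧ i < e' k).card) :
    ∃ f : (∀ k, ZMod ((q k : ℕ) ^ e k)) →+ (∀ k, ZMod ((q' k : ℕ) ^ e' k)), Injective f := by
  classical
  -- Factors with exponent `0` are trivial groups, which the counts do not see; they are dropped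
  -- before matching.
  obtain ⟨φ, hφ, hφ'⟩ := exists_injective_of_card_le (fun k : {k // 0 < e k} => q k.1)
    (fun k => e k.1) (fun k => k.2) q' e' (fun p i => by
      refine le_trans ?_ (h p i)
      rw [← Finset.card_map (Embedding.subtype _)]
      refine Finset.card_le_card fun k hk => ?_
      obtain ⟨k, hk', rfl⟩ := Finset.mem_map.1 hk
      exact Finset.mem_filter.2 ⟨mem_univ _, (Finset.mem_filter.1 hk').2⟩)
  have hj : ∀ k : {k // 0 < e k}, ∃ j : ZMod ((q k.1 : ℕ) ^ e k.1) →+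
      ZMod ((q' (φ k) : ℕ) ^ e' (φ k)), Injective j := by
    intro k
    obtain ⟨h1, h2⟩ := hφ' k
    have h3 : (q' (φ k) : ℕ) ^ e' (φ k) =
        (q k.1 : ℕ) ^ e k.1 * (q k.1 : ℕ) ^ (e' (φ k) - e k.1) := by
      rw [h1, ← pow_add, Nat.add_sub_cancel' h2]
    rw [h3]
    exact exists_injective_zmod _ _ (pow_pos (q k.1).2.pos _).ne'
  choose j hj using hj
  refine ⟨∑ k, (AddMonoidHom.single (fun k => ZMod ((q' k : ℕ) ^ e' k)) (φ k)).comp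
    ((j k).comp (Pi.evalAddMonoidHom _ k.1)), ?_⟩
  rw [injective_iff_map_eq_zero]
  intro x hx
  funext k
  by_cases hk : 0 < e k
  · have h1 := congrFun hx (φ ⟨k, hk⟩)
    rw [AddMonoidHom.finsetSum_apply, Finset.sum_apply,
      Finset.sum_eq_single ⟨k, hk⟩ (fun k' _ hk' => by
        simp [Pi.single_eq_of_ne (fun h => hk' (hφ h).symm)]) (by simp)] at h1
    simp only [AddMonoidHom.comp_apply, AddMonoidHom.single_apply, Pi.single_eq_same,
      Pi.evalAddMonoidHom_apply, Pi.zero_apply] at h1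
    exact (injective_iff_map_eq_zero _).1 (hj ⟨k, hk⟩) _ h1
  · have h0 : (q k : ℕ) ^ e k = 1 := by rw [Nat.eq_zero_of_not_pos hk, pow_zero]
    have : Subsingleton (ZMod ((q k : ℕ) ^ e k)) := by rw [h0]; infer_instance
    exact Subsingleton.elim _ _

/-- Embeddability of finite Abelian groups is decided by the torsion ranks. -/
lemma exists_injective_of_torsionRank_le {A B : Type*} [AddCommGroup A] [AddCommGroup B]
    [Finite A] [Finite B] (h : ∀ (p : Nat.Primes) i, torsionRank A p i ≤ torsionRank B p i) :
    ∃ f : A →+ B, Injective f := by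
  obtain ⟨K, _, q, e, ⟨a⟩⟩ := exists_addEquiv_pi_zmod A
  obtain ⟨K', _, q', e', ⟨b⟩⟩ := exists_addEquiv_pi_zmod B
  obtain ⟨f, hf⟩ := exists_injective_pi_zmod q e q' e' (fun p i => by
    rw [← torsionRank_pi_zmod, ← torsionRank_pi_zmod, ← torsionRank_congr a,
      ← torsionRank_congr b]
    exact h p i)
  exact ⟨b.symm.toAddMonoidHom.comp (f.comp a.toAddMonoidHom),
    b.symm.injective.comp (hf.comp a.injective)⟩

/-- Each group embeds in the other, and finiteness makes an embedding bijective. -/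
lemma nonempty_addEquiv_of_torsionRank_eq {A B : Type*} [AddCommGroup A] [AddCommGroup B]
    [Finite A] [Finite B] (h : ∀ (p : Nat.Primes) i, torsionRank A p i = torsionRank B p i) :
    Nonempty (A ≃+ B) := by
  obtain ⟨f, hf⟩ := exists_injective_of_torsionRank_le fun p i => (h p i).le
  obtain ⟨g, hg⟩ := exists_injective_of_torsionRank_le fun p i => (h p i).ge
  have hc := le_antisymm (Nat.card_le_card_of_injective f hf) (Nat.card_le_card_of_injective g hg)
  exact ⟨AddEquiv.ofBijective f ((Nat.bijective_iff_injective_and_card f).2 ⟨hf, hc⟩)⟩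

/-- The torsion ranks have finite support and determine the order. -/
lemma exists_finsupp_torsionRank (A : Type*) [AddCommGroup A] [Finite A] :
    ∃ R : Nat.Primes × ℕ →₀ ℕ, (∀ p i, R (p, i) = torsionRank A p i) ∧
      Nat.card A = R.prod fun c v => (c.1 : ℕ) ^ v := by
  classical
  obtain ⟨K, _, q, e, ⟨a⟩⟩ := exists_addEquiv_pi_zmod A
  -- A cyclic factor of order `q ^ e` adds `1` to the ranks at `q` with index below `e`.
  refine ⟨∑ k, ∑ i ∈ range (e k), Finsupp.single (q k, i) 1, fun p i => ?_, ?_⟩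
  · rw [torsionRank_congr a, torsionRank_pi_zmod, Finset.card_filter, Finsupp.finsetSum_apply]
    refine Finset.sum_congr rfl fun k _ => ?_
    rw [Finsupp.finsetSum_apply]
    simp only [Finsupp.single_apply, Prod.mk.injEq]
    by_cases h : q k = p
    · simp [h]
    · simp [h]
  · rw [Nat.card_congr a.toEquiv, Nat.card_pi,
      ← Finsupp.prod_finsetSum_index (by simp) (fun _ _ _ => pow_add _ _ _)]
    refine Finset.prod_congr rfl fun k _ => ?_
    rw [← Finsupp.prod_finsetSum_index (by simp) (fun _ _ _ => pow_add _ _ _), Nat.card_zmod]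
    simp

lemma torsionRank_antitone (A : Type*) [AddCommGroup A] [Finite A] (p : ℕ) :
    Antitone (torsionRank A p) := by
  refine antitone_nat_of_succ_le fun i => Nat.log_mono_right (Nat.card_le_card_of_injective
    (fun x : {x : A // p • x = 0 ∧ ∃ y : A, x = p ^ (i + 1) • y} =>
      (⟨x.1, x.2.1, by
        obtain ⟨y, hy⟩ := x.2.2
        exact ⟨p • y, by rw [hy, smul_smul, pow_succ]⟩⟩ :
        {x : A // p • x = 0 ∧ ∃ y : A, x = p ^ i • y})) fun x y h => ?_)
  exact Subtype.ext (congrArg (fun z => z.1) h)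

/-- Every finitely supported family of weakly decreasing sequences is the family of torsion ranks
of a finite Abelian group. -/
lemma exists_torsionRank_eq (f : Nat.Primes × ℕ →₀ ℕ) (hf : ∀ p, Antitone fun i => f (p, i)) :
    ∃ A : FinAbGroup, ∀ (p : Nat.Primes) i, torsionRank A p i = f (p, i) := by
  classical
  -- The cyclic factors are the parts of the conjugate partitions: `(p, k)` labels part `k` at `p`,
  -- and its exponent `e` is the first index at which `f` drops to `k` or below.
  let S : Finset (Nat.Primes × ℕ) := f.support.biUnion fun c => (range (f c)).image fun k => (c.1, k)
  have hS : ∀ p k, (p, k) ∈ S ↔ ∃ i, k < f (p, i) := by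
    intro p k
    simp only [S, Finset.mem_biUnion, Finset.mem_image, mem_range, Prod.mk.injEq]
    constructor
    · rintro ⟨⟨p', i⟩, -, k', hk', rfl, rfl⟩
      exact ⟨i, hk'⟩
    · rintro ⟨i, hi⟩
      exact ⟨(p, i), Finsupp.mem_support_iff.2 (by omega), k, hi, rfl, rfl⟩
  have hex : ∀ p k, ∃ i, f (p, i) ≤ k := by
    intro p k
    obtain ⟨i, hi⟩ := (f.comapDomain (fun i => (p, i))
      (Prod.mk_right_injective p).injOn).exists_forall_ge_eq_zero
    exact ⟨i, by simpa using (hi i le_rfl).le.trans (Nat.zero_le k)⟩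
  let e : S → ℕ := fun x => Nat.find (hex x.1.1 x.1.2)
  have he : ∀ (x : S) i, i < e x ↔ x.1.2 < f (x.1.1, i) := by
    intro x i
    rw [← not_le, ← not_le, not_iff_not, Nat.find_le_iff]
    constructor
    · rintro ⟨m, hm, hm'⟩
      exact (hf x.1.1 hm).trans hm'
    · intro h
      exact ⟨i, le_rfl, h⟩
  have : ∀ x : S, NeZero ((x.1.1 : ℕ) ^ e x) := fun x => ⟨(pow_pos x.1.1.2.pos _).ne'⟩
  have : Finite (∀ x : S, ZMod ((x.1.1 : ℕ) ^ e x)) := Pi.finite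
  refine ⟨⟨∀ x : S, ZMod ((x.1.1 : ℕ) ^ e x)⟩, fun p i => ?_⟩
  refine (torsionRank_pi_zmod (fun x : S => x.1.1) e p i).trans ?_
  rw [← Finset.card_range (f (p, i))]
  refine Finset.card_bij (fun x _ => x.1.2) ?_ ?_ ?_
  · rintro x hx
    simp only [mem_filter, he] at hx
    rw [mem_range, ← hx.2.1]
    exact hx.2.2
  · rintro x hx y hy hxy
    simp only [mem_filter] at hx hy
    exact Subtype.ext (Prod.ext (hx.2.1.trans hy.2.1.symm) hxy)
  · intro k hk
    rw [mem_range] at hk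
    refine ⟨⟨(p, k), (hS p k).2 ⟨i, hk⟩⟩, ?_, rfl⟩
    simp only [mem_filter, he]
    exact ⟨mem_univ _, trivial, hk⟩

end TorsionRank

/-! ### Chains of groups as families of plane partitions. -/

section GroupChains

namespace FinAbClass

/-- The torsion ranks of an isomorphism class. -/
noncomputable def rank (G : FinAbClass) (p : Nat.Primes) (i : ℕ) : ℕ := torsionRank G.rep p i

lemma rank_antitone (G : FinAbClass) (p : Nat.Primes) : Antitone (G.rank p) :=
  torsionRank_antitone _ _

lemma contains_iff_rank_le {G H : FinAbClass} :
    Contains G H ↔ ∀ p i, H.rank p i ≤ G.rank p i :=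
  ⟨fun ⟨f, hf⟩ p i => torsionRank_le_of_injective f hf p i, exists_injective_of_torsionRank_le⟩

lemma eq_of_rank_eq {G H : FinAbClass} (h : ∀ p i, G.rank p i = H.rank p i) : G = H := by
  rw [← mk_rep G, ← mk_rep H, mk_eq_mk]
  exact nonempty_addEquiv_of_torsionRank_eq h

lemma exists_rank_eq (f : Nat.Primes × ℕ →₀ ℕ) (hf : ∀ p, Antitone fun i => f (p, i)) :
    ∃ G : FinAbClass, ∀ p i, G.rank p i = f (p, i) := by
  obtain ⟨A, hA⟩ := exists_torsionRank_eq f hf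
  obtain ⟨e⟩ := nonempty_rep_mk A
  exact ⟨mk A, fun p i => (torsionRank_congr e p i).trans (hA p i)⟩

lemma subsingleton_rep_zeroClass : Subsingleton zeroClass.rep := by
  obtain ⟨e⟩ := nonempty_rep_mk ⟨PUnit⟩
  exact e.toEquiv.subsingleton

lemma eq_zeroClass_of_subsingleton {G : FinAbClass} (h : Subsingleton G.rep) : G = zeroClass := by
  rw [← mk_rep G, zeroClass, mk_eq_mk]
  have : Subsingleton (FinAbGroup.carrier ⟨PUnit⟩) := inferInstanceAs (Subsingleton PUnit)
  exact ⟨{ toFun := fun _ => 0, invFun := fun _ => 0, left_inv := fun _ => Subsingleton.elim _ _,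
           right_inv := fun _ => Subsingleton.elim _ _, map_add' := fun _ _ => by simp }⟩

lemma rank_zeroClass (p : Nat.Primes) (i : ℕ) : zeroClass.rank p i = 0 := by
  have := subsingleton_rep_zeroClass
  rw [rank, torsionRank, Nat.log_eq_zero_iff]
  exact Or.inl (Finite.card_le_one_iff_subsingleton.2 inferInstance |>.trans_lt p.2.one_lt)

lemma exists_finsupp_rank (G : FinAbClass) : ∃ R : Nat.Primes × ℕ →₀ ℕ,
    (∀ p i, R (p, i) = G.rank p i) ∧ G.order = R.prod fun c v => (c.1 : ℕ) ^ v :=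
  exists_finsupp_torsionRank G.rep

/-- A direct sum of a sequence that is trivial from `M` on is a finite product. -/
noncomputable def directSumEquivPi (g : ℕ → FinAbClass) (M : ℕ)
    (hM : ∀ j, M ≤ j → g j = zeroClass) :
    (⨁ j, (g j).rep) ≃ ∀ j : Fin M, (g j).rep := by
  classical
  have hsub : ∀ j, M ≤ j → Subsingleton (g j).rep := fun j hj => by
    rw [hM j hj]
    exact subsingleton_rep_zeroClass
  refine Equiv.ofBijective (fun x j => x j) ⟨fun x y h => DFinsupp.ext fun j => ?_, fun y => ?_⟩
  · by_cases hj : j < M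
    · exact congrFun h ⟨j, hj⟩
    · have := hsub j (not_lt.1 hj)
      exact Subsingleton.elim _ _
  · refine ⟨DirectSum.mk _ (range M) fun j => y ⟨j.1, mem_range.1 j.2⟩, funext fun j => ?_⟩
    exact DirectSum.mk_apply_of_mem (mem_range.2 j.2)

lemma finite_directSum (g : ℕ → FinAbClass) (M : ℕ) (hM : ∀ j, M ≤ j → g j = zeroClass) :
    Finite (⨁ j, (g j).rep) :=
  Finite.of_equiv _ (directSumEquivPi g M hM).symm

lemma card_directSum (g : ℕ → FinAbClass) (M : ℕ) (hM : ∀ j, M ≤ j → g j = zeroClass) :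
    Nat.card (⨁ j, (g j).rep) = ∏ j ∈ range M, (g j).order := by
  rw [Nat.card_congr (directSumEquivPi g M hM), Nat.card_pi, Finset.prod_range]
  rfl

/-- Nonzero elements of different summands are different in the direct sum, so a finite sum has
finitely many nontrivial summands. -/
lemma exists_forall_eq_zeroClass (g : ℕ → FinAbClass) (h : Finite (⨁ j, (g j).rep)) :
    ∃ M, ∀ j, M ≤ j → g j = zeroClass := by
  classical
  have hfin : {j | g j ≠ zeroClass}.Finite := by
    have hx : ∀ j : {j | g j ≠ zeroClass}, ∃ x : (g j).rep, x ≠ 0 := by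
      rintro ⟨j, hj⟩
      by_contra! hall
      exact hj (eq_zeroClass_of_subsingleton ⟨fun a b => (hall a).trans (hall b).symm⟩)
    choose x hx using hx
    refine Set.finite_coe_iff.1 (Finite.of_injective
      (fun j => DirectSum.of (fun j => (g j).rep) j.1 (x j)) fun j j' hjj' => ?_)
    by_contra hne
    refine hx j ?_
    have h1 := DFinsupp.ext_iff.1 hjj' j.1
    rw [DirectSum.of_eq_same, DirectSum.of_eq_of_ne] at h1
    · exact h1
    · exact fun h => hne (Subtype.ext h)
  obtain ⟨M, hM⟩ := hfin.bddAbove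
  refine ⟨M + 1, fun j hj => ?_⟩
  by_contra hne
  have := hM hne
  omega

/-- Finitely supported chains of isomorphism classes with at most `r` nontrivial terms. -/
def chains (r : ℕ∞) : Set (ℕ → FinAbClass) :=
  {g | (∀ j, Contains (g j) (g (j + 1))) ∧ (∀ j : ℕ, r ≤ (j : ℕ∞) → g j = zeroClass) ∧
    Finite (⨁ j, (g j).rep)}

/-- Rows decrease because the ranks of one group do, columns because of the containments; the bound
`r` on the terms becomes a bound on the rows. -/
lemma exists_planePartitions_of_chain {r : ℕ∞} {g : ℕ → FinAbClass} (hg : g ∈ chains r) :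
    ∃ F : Nat.Primes →₀ PlanePartition r, ∀ p j i, (F p).1 (j, i) = (g j).rank p i := by
  classical
  obtain ⟨hg1, hg2, hg3⟩ := hg
  obtain ⟨M, hM⟩ := exists_forall_eq_zeroClass g hg3
  choose R hR _ using fun j => exists_finsupp_rank (g j)
  have hzero : ∀ j, M ≤ j → ∀ p i, (g j).rank p i = 0 := fun j hj p i => by
    rw [hM j hj, rank_zeroClass]
  let Q : Finset (Nat.Primes × ℕ) := (range M).biUnion fun j => (R j).support
  have hQ : ∀ p j i, (g j).rank p i ≠ 0 → (p, i) ∈ Q ∧ j < M := by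
    intro p j i h
    have hj : j < M := by
      by_contra hj
      exact h (hzero j (not_lt.1 hj) p i)
    exact ⟨Finset.mem_biUnion.2 ⟨j, mem_range.2 hj, Finsupp.mem_support_iff.2 (by rwa [hR])⟩, hj⟩
  let P : Nat.Primes → PlanePartition r := fun p =>
    ⟨Finsupp.onFinset (range M ×ˢ Q.image Prod.snd) (fun c => (g c.1).rank p c.2) (by
      rintro ⟨j, i⟩ h
      obtain ⟨h1, h2⟩ := hQ p j i h
      exact Finset.mem_product.2 ⟨mem_range.2 h2, Finset.mem_image.2 ⟨_, h1, rfl⟩⟩),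
      antitone_prod_of_succ (fun j i => contains_iff_rank_le.1 (hg1 j) p i)
        (fun j i => (g j).rank_antitone p (Nat.le_succ i)),
      fun j i hji => by
        change (g j).rank p i = 0
        rw [hg2 j (hji.resolve_right (by simp)), rank_zeroClass]⟩
  refine ⟨Finsupp.onFinset (Q.image Prod.fst) P fun p hp => ?_, fun p j i => rfl⟩
  by_contra hpQ
  refine hp (Subtype.ext (Finsupp.ext ?_))
  rintro ⟨j, i⟩
  by_contra h
  exact hpQ (Finset.mem_image.2 ⟨_, (hQ p j i h).1, rfl⟩)

lemma degree_bound {r : ℕ∞} (F : Nat.Primes →₀ PlanePartition r) :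
    ∃ D, ∀ p j i, (F p).1 (j, i) ≠ 0 → p ∈ F.support ∧ j < D ∧ i < D := by
  classical
  refine ⟨F.support.sup fun p => (F p).1.degree, fun p j i h => ?_⟩
  have hp : p ∈ F.support := Finsupp.mem_support_iff.2 fun h0 => h (by rw [h0]; rfl)
  have h1 := (F p).2.lt_degree h
  have h2 := Finset.le_sup (f := fun p => (F p).1.degree) hp
  exact ⟨hp, h1.1.trans_le h2, h1.2.trans_le h2⟩

lemma eq_zeroClass_of_rank_eq {r : ℕ∞} {F : Nat.Primes →₀ PlanePartition r}
    {g : ℕ → FinAbClass} (h : ∀ p j i, (F p).1 (j, i) = (g j).rank p i) {D : ℕ}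
    (hD : ∀ p j i, (F p).1 (j, i) ≠ 0 → p ∈ F.support ∧ j < D ∧ i < D) (j : ℕ) (hj : D ≤ j) :
    g j = zeroClass := by
  refine eq_of_rank_eq fun p i => ?_
  rw [rank_zeroClass, ← h]
  by_contra hne
  have := (hD p j i hne).2.1
  omega

lemma exists_chain_of_planePartitions {r : ℕ∞} (F : Nat.Primes →₀ PlanePartition r) :
    ∃ g ∈ chains r, ∀ p j i, (F p).1 (j, i) = (g j).rank p i := by
  classical
  obtain ⟨D, hD⟩ := degree_bound F
  have hex : ∀ j, ∃ G : FinAbClass, ∀ p i, G.rank p i = (F p).1 (j, i) := fun j =>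
    exists_rank_eq (Finsupp.onFinset (F.support ×ˢ range D) (fun c => (F c.1).1 (j, c.2)) (by
      rintro ⟨p, i⟩ h
      obtain ⟨h1, -, h2⟩ := hD p j i h
      exact Finset.mem_product.2 ⟨h1, mem_range.2 h2⟩))
      (fun p => antitone_nat_of_succ_le fun i => (F p).2.succ_right j i)
  choose g hg using hex
  have hgF : ∀ p j i, (F p).1 (j, i) = (g j).rank p i := fun p j i => (hg j p i).symm
  refine ⟨g, ⟨fun j => contains_iff_rank_le.2 fun p i => ?_, fun j hj => ?_, ?_⟩, hgF⟩
  · rw [hg, hg]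
    exact (F p).2.succ_left j i
  · refine eq_of_rank_eq fun p i => ?_
    rw [hg, rank_zeroClass]
    exact (F p).2.2 j i (Or.inl hj)
  · exact finite_directSum g D (eq_zeroClass_of_rank_eq hgF hD)

/-- The exponent of `p` in the order of `g j` is the sum of row `j` of `F p`; adding the rows gives
the degree. -/
lemma card_directSum_of_rank_eq {r : ℕ∞} {F : Nat.Primes →₀ PlanePartition r}
    {g : ℕ → FinAbClass} (h : ∀ p j i, (F p).1 (j, i) = (g j).rank p i) :
    Nat.card (⨁ j, (g j).rep) = F.prod fun p f => (p : ℕ) ^ f.1.degree := by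
  classical
  obtain ⟨D, hD⟩ := degree_bound F
  rw [card_directSum g D (eq_zeroClass_of_rank_eq h hD)]
  have horder : ∀ j, (g j).order = ∏ p ∈ F.support, ∏ i ∈ range D, (p : ℕ) ^ (F p).1 (j, i) := by
    intro j
    obtain ⟨R, hR, hR'⟩ := exists_finsupp_rank (g j)
    rw [hR', ← Finset.prod_product']
    rw [Finsupp.prod_of_support_subset (s := F.support ×ˢ range D)]
    · exact Finset.prod_congr rfl fun c _ => by rw [h, ← hR]
    · rintro ⟨p, i⟩ hpi
      rw [Finsupp.mem_support_iff, hR, ← h] at hpi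
      obtain ⟨h1, -, h2⟩ := hD p j i hpi
      exact Finset.mem_product.2 ⟨h1, mem_range.2 h2⟩
    · simp
  simp only [horder]
  rw [Finset.prod_comm, Finsupp.prod]
  refine Finset.prod_congr rfl fun p _ => ?_
  rw [← Finset.prod_product', Finset.prod_pow_eq_pow_sum, Finsupp.degree_apply]
  congr 1
  refine (Finset.sum_subset (fun c hc => ?_) (fun c _ hc => by simpa using hc)).symm
  obtain ⟨-, h1, h2⟩ := hD p c.1 c.2 (Finsupp.mem_support_iff.1 hc)
  exact Finset.mem_product.2 ⟨mem_range.2 h1, mem_range.2 h2⟩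

/-- Chains of finite Abelian groups are families of plane partitions indexed by the primes. -/
lemma exists_chains_equiv (r : ℕ∞) : ∃ e : chains r ≃ (Nat.Primes →₀ PlanePartition r),
    ∀ g, (e g).prod (fun p f => (p : ℕ) ^ f.1.degree) = Nat.card (⨁ j, (g.1 j).rep) := by
  choose F hF using fun g : chains r => exists_planePartitions_of_chain g.2
  refine ⟨Equiv.ofBijective F ⟨fun g g' hgg' => ?_, fun f => ?_⟩, fun g =>
    (card_directSum_of_rank_eq (hF g)).symm⟩
  · refine Subtype.ext (funext fun j => eq_of_rank_eq fun p i => ?_)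
    rw [← hF, ← hF, hgg']
  · obtain ⟨g, hg, hgf⟩ := exists_chain_of_planePartitions f
    refine ⟨⟨g, hg⟩, Finsupp.ext fun p => Subtype.ext (Finsupp.ext fun c => ?_)⟩
    rw [← Prod.mk.eta (p := c), hF, hgf]

lemma isGroupPartition_and_iff {r : ℕ∞} {G : FinAbClass} {g : ℕ → FinAbClass} :
    (IsGroupPartition G g ∧ ∀ j : ℕ, r ≤ (j : ℕ∞) → g j = zeroClass) ↔
      g ∈ chains r ∧ Nonempty (G.rep ≃+ ⨁ j, (g j).rep) := by
  constructor
  · rintro ⟨⟨⟨e⟩, h1⟩, h2⟩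
    exact ⟨⟨h1, h2, Finite.of_equiv _ e.toEquiv⟩, ⟨e⟩⟩
  · rintro ⟨⟨h1, h2, -⟩, he⟩
    exact ⟨⟨he, h1⟩, h2⟩

end FinAbClass

-- A chain partitions exactly one class, that of its direct sum, so the sum over `G` counts fibres.
-- Finiteness is required since `finsum` and the cardinalities default to `0` in infinite cases.
open FinAbClass in
lemma groupPartitionFun_eq_card (r : ℕ∞) (n : ℕ)
    (hfin : {g ∈ chains r | Nat.card (⨁ j, (g j).rep) = n}.Finite) :
    groupPartitionFun r n = Nat.card {g : chains r // Nat.card (⨁ j, (g.1 j).rep) = n} := by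
  classical
  -- The value `zeroClass` is a default that no member of `chains r` takes by that branch.
  let cl : (ℕ → FinAbClass) → FinAbClass := fun g =>
    if h : Finite (⨁ j, (g j).rep) then mk ⟨⨁ j, (g j).rep⟩ else zeroClass
  have hcl : ∀ g ∈ chains r, ∀ G : FinAbClass,
      Nonempty (G.rep ≃+ ⨁ j, (g j).rep) ↔ cl g = G := by
    intro g hg G
    have := hg.2.2
    simp only [cl, dif_pos this]
    conv_rhs => rw [← mk_rep G]
    rw [eq_comm, mk_eq_mk]
  have horder : ∀ g ∈ chains r, (cl g).order = Nat.card (⨁ j, (g j).rep) := by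
    intro g hg
    have := hg.2.2
    simp only [cl, dif_pos this]
    exact order_mk _
  have hterm : ∀ G : FinAbClass, (∑ᶠ (_ : G.order = n), G.partitionCount r) =
      (hfin.toFinset.filter fun g => cl g = G).card := by
    intro G
    by_cases hG : G.order = n
    · rw [finsum_eq_if, if_pos hG, partitionCount, ← Set.ncard_coe_finset]
      congr 1
      ext g
      simp only [isGroupPartition_and_iff, Set.mem_ofPred_eq, Finset.coe_filter,
        Set.Finite.mem_toFinset]
      constructor
      · rintro ⟨h1, h2⟩
        rw [hcl g h1] at h2
        exact ⟨⟨h1, by rw [← horder g h1, h2, hG]⟩, h2⟩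
      · rintro ⟨⟨h1, -⟩, h2⟩
        exact ⟨h1, (hcl g h1 G).2 h2⟩
    · rw [finsum_eq_if, if_neg hG, eq_comm, Finset.card_eq_zero, Finset.filter_eq_empty_iff]
      rintro g hg rfl
      rw [Set.Finite.mem_toFinset] at hg
      exact hG ((horder g hg.1).trans hg.2)
  rw [groupPartitionFun]
  simp only [hterm]
  rw [finsum_eq_sum_of_support_subset (s := hfin.toFinset.image cl), ← Finset.card_eq_sum_card_image]
  · rw [← Nat.card_eq_card_finite_toFinset]
    refine Nat.card_congr
      { toFun := fun g => ⟨⟨g.1, g.2.1⟩, g.2.2⟩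
        invFun := fun g => ⟨g.1.1, g.1.2, g.2⟩
        left_inv := fun _ => rfl
        right_inv := fun _ => rfl }
  · intro G hG
    rw [Function.mem_support, Finset.card_ne_zero] at hG
    obtain ⟨g, hg⟩ := hG
    rw [Finset.mem_filter] at hg
    exact Finset.mem_coe.2 (Finset.mem_image.2 ⟨g, hg.1, hg.2⟩)

end GroupChains

/-! ### Infinite products of geometric series and their grouping. -/

section InfiniteProducts

lemma norm_one_sub_inv_sub_one_le {z : ℂ} (hz : ‖z‖ ≤ 1 / 2) : ‖(1 - z)⁻¹ - 1‖ ≤ 2 * ‖z‖ := by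
  have h1 : 1 / 2 ≤ ‖1 - z‖ := by
    have := norm_sub_norm_le (1 : ℂ) z
    rw [norm_one] at this
    linarith
  have h0 : 1 - z ≠ 0 := norm_pos_iff.1 (by linarith)
  have : (1 - z)⁻¹ - 1 = z * (1 - z)⁻¹ := by
    field_simp
    ring
  rw [this, norm_mul, norm_inv, mul_comm]
  gcongr
  exact inv_le_of_inv_le₀ (by norm_num) (by linarith)

/-- For `0 ≤ y ≤ 1 / 2` one has `(1 - y)⁻¹ ≤ 1 + 2 * y ≤ exp (2 * y)`. -/
lemma prod_one_sub_inv_le_exp {ι : Type*} {y : ι → ℝ} (hy0 : ∀ i, 0 ≤ y i)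
    (hy : ∀ i, y i ≤ 1 / 2) (hs : Summable y) (S : Finset ι) :
    ∏ i ∈ S, (1 - y i)⁻¹ ≤ Real.exp (2 * ∑' i, y i) := by
  calc ∏ i ∈ S, (1 - y i)⁻¹ ≤ ∏ i ∈ S, Real.exp (2 * y i) := by
        refine Finset.prod_le_prod (fun i _ => inv_nonneg.2 (by linarith [hy i])) fun i _ => ?_
        have h1 := hy i
        have h2 := hy0 i
        refine le_trans ?_ (Real.add_one_le_exp _)
        rw [inv_le_iff_one_le_mul₀ (by linarith)]
        nlinarith
    _ = Real.exp (2 * ∑ i ∈ S, y i) := by rw [← Real.exp_sum, Finset.mul_sum]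
    _ ≤ _ := by
        gcongr
        exact hs.sum_le_tsum S fun i _ => hy0 i

/-- Finitely many exponent vectors are supported in a common finite set, so every partial sum is
below a finite product, and these are uniformly bounded. -/
lemma summable_finsupp_geometric_real {ι : Type*} {y : ι → ℝ} (hy0 : ∀ i, 0 ≤ y i)
    (hy : ∀ i, y i ≤ 1 / 2) (hs : Summable y) :
    Summable fun a : ι →₀ ℕ => a.prod fun i n => y i ^ n := by
  classical
  refine summable_of_sum_le (c := Real.exp (2 * ∑' i, y i))
    (fun a => Finset.prod_nonneg fun i _ => pow_nonneg (hy0 i) _) fun T => ?_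
  let S : Finset ι := T.biUnion fun a => a.support
  have hS : ∀ a ∈ T, a.support ⊆ S := fun a ha => Finset.subset_biUnion_of_mem _ ha
  obtain ⟨h1, h2⟩ := hasSum_finsupp_geometric_finset y S fun i => by
    rw [Real.norm_of_nonneg (hy0 i)]
    linarith [hy i]
  calc ∑ a ∈ T, a.prod (fun i n => y i ^ n)
      = ∑ a ∈ T.subtype (fun a => a.support ⊆ S), a.1.prod (fun i n => y i ^ n) :=
        (Finset.sum_subtype_of_mem (fun a : ι →₀ ℕ => a.prod fun i n => y i ^ n) hS).symm
    _ ≤ ∏ i ∈ S, (1 - y i)⁻¹ := sum_le_hasSum _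
        (fun a _ => Finset.prod_nonneg fun i _ => pow_nonneg (hy0 i) _) h2
    _ ≤ _ := prod_one_sub_inv_le_exp hy0 hy hs S

lemma summable_norm_finsupp_geometric {ι : Type*} {z : ι → ℂ} (hz : ∀ i, ‖z i‖ ≤ 1 / 2)
    (hs : Summable fun i => ‖z i‖) :
    Summable fun a : ι →₀ ℕ => ‖a.prod fun i n => z i ^ n‖ := by
  refine (summable_finsupp_geometric_real (fun i => norm_nonneg (z i)) hz hs).congr fun a => ?_
  simp only [Finsupp.prod, norm_prod, norm_pow]

/-- The expansion of an infinite product of geometric series. -/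
lemma hasProd_one_sub_inv {ι : Type*} {z : ι → ℂ} (hz : ∀ i, ‖z i‖ ≤ 1 / 2)
    (hs : Summable fun i => ‖z i‖) :
    HasProd (fun i => (1 - z i)⁻¹) (∑' a : ι →₀ ℕ, a.prod fun i n => z i ^ n) := by
  classical
  -- A finite partial product is the full series restricted to vectors supported in `S`; dominated
  -- convergence then applies as `S` grows.
  have h1 : ∀ S : Finset ι, ∏ i ∈ S, (1 - z i)⁻¹ =
      ∑' a : ι →₀ ℕ, {a : ι →₀ ℕ | a.support ⊆ S}.indicator (fun a => a.prod fun i n => z i ^ n) a := by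
    intro S
    rw [← _root_.tsum_subtype]
    exact (hasSum_finsupp_geometric_finset z S fun i => (hz i).trans_lt (by norm_num)).2.tsum_eq.symm
  rw [HasProd, SummationFilter.unconditional_filter]
  simp only [h1]
  refine tendsto_tsum_of_dominated_convergence (summable_norm_finsupp_geometric hz hs)
    (fun a => ?_) (Filter.Eventually.of_forall fun S a => norm_indicator_le_norm_self _ _)
  refine tendsto_const_nhds.congr' ?_
  filter_upwards [Filter.eventually_ge_atTop a.support] with S hS
  exact (Set.indicator_of_mem (show a ∈ {a : ι →₀ ℕ | a.support ⊆ S} from hS)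
    (fun a : ι →₀ ℕ => a.prod fun i n => z i ^ n)).symm

lemma norm_sub_one_le_of_hasProd {γ : Type*} {u : γ → ℂ} {P : ℂ}
    (hu : Summable fun c => ‖u c - 1‖) (hP : HasProd u P) :
    ‖P - 1‖ ≤ Real.exp (∑' c, ‖u c - 1‖) - 1 := by
  rw [HasProd, SummationFilter.unconditional_filter] at hP
  refine le_of_tendsto (hP.sub_const 1).norm (Filter.Eventually.of_forall fun S => ?_)
  have h := Finset.norm_prod_one_add_sub_one_le S fun c => u c - 1
  simp only [add_sub_cancel] at h
  refine h.trans (sub_le_sub_right (Real.exp_le_exp.2 ?_) 1)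
  exact hu.sum_le_tsum S fun _ _ => norm_nonneg _

/-- Grouping the factors of an absolutely convergent product preserves absolute convergence. -/
lemma summable_norm_sub_one_of_hasProd_sigma {β : Type*} {γ : β → Type*} {u : (Σ b, γ b) → ℂ}
    {P : β → ℂ} (hu : Summable fun c => ‖u c - 1‖) (hP : ∀ b, HasProd (fun c => u ⟨b, c⟩) (P b)) :
    Summable fun b => ‖P b - 1‖ := by
  set T := ∑' c, ‖u c - 1‖
  have hs := hu.sigma
  refine Summable.of_nonneg_of_le (fun _ => norm_nonneg _) (fun b => ?_) (hs.mul_right (Real.exp T))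
  refine (norm_sub_one_le_of_hasProd (hu.sigma_factor b) (hP b)).trans ?_
  set t := ∑' c, ‖u ⟨b, c⟩ - 1‖ with ht
  have ht0 : 0 ≤ t := tsum_nonneg fun _ => norm_nonneg _
  have htT : t ≤ T := by
    rw [show T = ∑' b, ∑' c, ‖u ⟨b, c⟩ - 1‖ from hu.tsum_sigma]
    exact hs.le_tsum b fun _ _ => tsum_nonneg fun _ => norm_nonneg _
  -- This is `1 - t ≤ exp (-t)` multiplied by `exp t`.
  have h1 : Real.exp t - 1 ≤ t * Real.exp t := by
    have h2 := Real.add_one_le_exp (-t)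
    have h3 : Real.exp (-t) * Real.exp t = 1 := by rw [← Real.exp_add, neg_add_cancel, Real.exp_zero]
    nlinarith [Real.exp_pos t]
  exact h1.trans (mul_le_mul_of_nonneg_left (Real.exp_le_exp.2 htT) ht0)

end InfiniteProducts

/-! ### The Dirichlet series as a sum over arrays, and its Euler product. -/

section DirichletSeries

/-- The number of an array of exponents indexed by primes and cells. -/
noncomputable def arrayNumber {r : ℕ∞} (a : Nat.Primes × RowCell r →₀ ℕ) : ℕ :=
  a.prod fun c v => ((c.1 : ℕ) ^ c.2.hook) ^ v

lemma arrayNumber_ne_zero {r : ℕ∞} (a : Nat.Primes × RowCell r →₀ ℕ) : arrayNumber a ≠ 0 :=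
  Finset.prod_ne_zero_iff.2 fun c _ => pow_ne_zero _ (pow_ne_zero _ c.1.2.ne_zero)

lemma exists_chains_equiv_array (r : ℕ∞) :
    ∃ e : FinAbClass.chains r ≃ (Nat.Primes × RowCell r →₀ ℕ),
      ∀ g, arrayNumber (e g) = Nat.card (⨁ j, (g.1 j).rep) := by
  obtain ⟨e₁, he₁⟩ := FinAbClass.exists_chains_equiv r
  obtain ⟨e₂, he₂⟩ := exists_planePartition_equiv r
  -- Hooks are positive, so only the zero array has weight `0`. This is needed to apply `e₂` prime
  -- by prime without losing finite support.
  have h0 : e₂ 0 = 0 := by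
    have h := he₂ 0
    by_contra hne
    obtain ⟨c, hc⟩ := Finsupp.support_nonempty_iff.2 hne
    have := hook_le_hookWeight _ hc
    rw [h, show (0 : PlanePartition r).1.degree = 0 from map_zero Finsupp.degree] at this
    simp [RowCell.hook] at this
  refine ⟨e₁.trans ((Finsupp.mapRange.equiv e₂ h0).trans Finsupp.curryEquiv.symm), fun g => ?_⟩
  rw [← he₁, arrayNumber]
  set F := e₁ g
  have h1 : ∀ b : Nat.Primes →₀ (RowCell r →₀ ℕ),
      (Finsupp.curryEquiv.symm b).prod (fun c v => ((c.1 : ℕ) ^ c.2.hook) ^ v) =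
        b.prod fun p a => (p : ℕ) ^ hookWeight a := by
    intro b
    simp only [pow_hookWeight]
    exact congrArg Additive.toMul (Finsupp.sum_uncurry_index' (N := Additive ℕ) b
      fun p c v => Additive.ofMul (((p : ℕ) ^ c.hook) ^ v))
  simp only [Equiv.trans_apply]
  rw [h1, Finsupp.mapRange.equiv_apply, Finsupp.prod_mapRange_index (by simp [hookWeight])]
  simp only [he₂, F]

/-- `a_r(n)` counts arrays. -/
lemma groupPartitionFun_eq_card_array (r : ℕ∞) (n : ℕ)
    (hfin : Finite {a : Nat.Primes × RowCell r →₀ ℕ // arrayNumber a = n}) :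
    groupPartitionFun r n = Nat.card {a : Nat.Primes × RowCell r →₀ ℕ // arrayNumber a = n} := by
  obtain ⟨e, he⟩ := exists_chains_equiv_array r
  have e' : {g : FinAbClass.chains r // Nat.card (⨁ j, (g.1 j).rep) = n} ≃
      {a : Nat.Primes × RowCell r →₀ ℕ // arrayNumber a = n} :=
    e.subtypeEquiv fun g => by rw [he]
  have hfin' := Finite.of_equiv _ e'.symm
  rw [← Nat.card_congr e']
  refine groupPartitionFun_eq_card r n ?_
  refine (Set.finite_range fun g : {g : FinAbClass.chains r //
    Nat.card (⨁ j, (g.1 j).rep) = n} => g.1.1).subset ?_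
  rintro g ⟨hg, hn⟩
  exact ⟨⟨⟨g, hg⟩, hn⟩, rfl⟩

variable {N : ℕ} (χ : DirichletCharacter ℂ N) {s : ℂ}

lemma dirichletSummandHom_apply' (hs : s ≠ 0) (n : ℕ) :
    dirichletSummandHom χ hs n = χ (n : ZMod N) * (n : ℂ) ^ (-s) := rfl

lemma norm_dirichletSummandHom_prime_le (hs : s ≠ 0) (p : Nat.Primes) :
    ‖dirichletSummandHom χ hs p‖ ≤ (p : ℝ) ^ (-s.re) := by
  rw [dirichletSummandHom_apply', norm_mul, Complex.norm_natCast_cpow_of_pos p.2.pos, Complex.neg_re]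
  exact mul_le_of_le_one_left (Real.rpow_nonneg (Nat.cast_nonneg _) _)
    (DirichletCharacter.norm_le_one χ _)

lemma prime_rpow_le_half (hs : 1 < s.re) (p : Nat.Primes) : (p : ℝ) ^ (-s.re) ≤ 1 / 2 := by
  have h2 : (2 : ℝ) ≤ (p : ℝ) := by exact_mod_cast p.2.two_le
  calc (p : ℝ) ^ (-s.re) ≤ (p : ℝ) ^ (-1 : ℝ) :=
        Real.rpow_le_rpow_of_exponent_le (by linarith) (by linarith)
    _ = (p : ℝ)⁻¹ := Real.rpow_neg_one _
    _ ≤ 1 / 2 := by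
        rw [one_div]
        exact inv_anti₀ (by norm_num) h2

/-- One factor `p ^ (-s.re)` is kept for the sum over `p`; the others, at most `1 / 2`, serve the
sum over `m`. -/
lemma norm_dirichletSummandHom_pow_le (hs0 : s ≠ 0) (hs : 1 < s.re) (m : ℕ) (hm : m ≠ 0)
    (p : Nat.Primes) :
    ‖dirichletSummandHom χ hs0 p ^ m‖ ≤ (1 / 2) ^ (m - 1) * (p : ℝ) ^ (-s.re) := by
  obtain ⟨m, rfl⟩ := Nat.exists_eq_succ_of_ne_zero hm
  have h := norm_dirichletSummandHom_prime_le χ hs0 p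
  rw [norm_pow, pow_succ, Nat.succ_sub_one]
  gcongr
  exact h.trans (prime_rpow_le_half hs p)

/-- The factors of the product, repeated according to their exponents. -/
abbrev FactorIndex (r : ℕ∞) : Type := Σ mp : ℕ+ × Nat.Primes, Fin (minExponent mp.1 r)

lemma summable_norm_factors (r : ℕ∞) (hs0 : s ≠ 0) (hs : 1 < s.re) :
    Summable fun c : FactorIndex r => ‖dirichletSummandHom χ hs0 c.1.2 ^ (c.1.1 : ℕ)‖ := by
  rw [summable_sigma_of_nonneg fun _ => norm_nonneg _]
  refine ⟨fun _ => Summable.of_finite, ?_⟩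
  -- The factor `m` bounds the multiplicity `minExponent m r`.
  have h1 : Summable fun m : ℕ+ => ((m : ℕ) : ℝ) * (1 / 2) ^ ((m : ℕ) - 1) := by
    have h := (summable_pow_mul_geometric_of_norm_lt_one 1
      (show ‖(1 / 2 : ℝ)‖ < 1 by norm_num)).mul_left 2
    refine (h.comp_injective PNat.coe_injective).congr fun m => ?_
    obtain ⟨k, hk⟩ := Nat.exists_eq_succ_of_ne_zero m.ne_zero
    simp only [Function.comp_apply, hk, Nat.succ_sub_one, pow_succ]
    ring
  have h2 : Summable fun p : Nat.Primes => (p : ℝ) ^ (-s.re) :=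
    Nat.Primes.summable_rpow.2 (by linarith)
  refine Summable.of_nonneg_of_le (fun _ => tsum_nonneg fun _ => norm_nonneg _) (fun mp => ?_)
    (h1.mul_of_nonneg h2 (fun m => by positivity) fun p => by positivity)
  have h3 : ∑' i : Fin (minExponent mp.1 r), ‖dirichletSummandHom χ hs0 mp.2 ^ (mp.1 : ℕ)‖ =
      minExponent mp.1 r * ‖dirichletSummandHom χ hs0 mp.2 ^ (mp.1 : ℕ)‖ := by
    rw [tsum_const, Nat.card_fin, nsmul_eq_mul]
  refine h3.trans_le ?_
  rw [mul_assoc]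
  have hle : minExponent mp.1 r ≤ (mp.1 : ℕ) := by
    have h := coe_minExponent mp.1 r
    exact_mod_cast h.le.trans (min_le_left _ _)
  gcongr
  exact norm_dirichletSummandHom_pow_le χ hs0 hs _ mp.1.ne_zero mp.2

/-- Primes and cells index the factors, `m` being the hook length. -/
def cellFactorEquiv (r : ℕ∞) : Nat.Primes × RowCell r ≃ FactorIndex r where
  toFun c := ⟨(⟨c.2.hook, Nat.succ_pos _⟩, c.1),
    ⟨c.2.1.1, lt_minExponent.2 ⟨by simp [RowCell.hook], c.2.2⟩⟩⟩
  invFun c := (c.1.2, ⟨(c.2, c.1.1 - 1 - c.2), (lt_minExponent.1 c.2.2).2⟩)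
  left_inv := by
    rintro ⟨p, ⟨i, j⟩, h⟩
    simp [RowCell.hook]
  right_inv := by
    rintro ⟨⟨m, p⟩, i⟩
    have h1 := (lt_minExponent.1 i.2).1
    have h2 : (⟨(i : ℕ) + ((m : ℕ) - 1 - i) + 1, Nat.succ_pos _⟩ : ℕ+) = m := by
      apply PNat.eq
      change (i : ℕ) + ((m : ℕ) - 1 - i) + 1 = m
      simp only at h1
      omega
    refine Sigma.ext (Prod.ext h2 rfl) ?_
    simp only [RowCell.hook]
    rw [Fin.heq_ext_iff (by rw [h2])]

lemma dirichletSummandHom_arrayNumber {r : ℕ∞} (hs0 : s ≠ 0) (a : Nat.Primes × RowCell r →₀ ℕ) :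
    dirichletSummandHom χ hs0 (arrayNumber a) =
      a.prod fun c v => (dirichletSummandHom χ hs0 c.1 ^ c.2.hook) ^ v := by
  rw [arrayNumber, map_finsuppProd]
  simp only [map_pow]

lemma summable_norm_cells (r : ℕ∞) (hs0 : s ≠ 0) (hs : 1 < s.re) :
    Summable fun c : Nat.Primes × RowCell r => ‖dirichletSummandHom χ hs0 c.1 ^ c.2.hook‖ :=
  (cellFactorEquiv r).summable_iff.2 (summable_norm_factors χ r hs0 hs)

lemma norm_dirichletSummandHom_pow_le_half (hs0 : s ≠ 0) (hs : 1 < s.re) (m : ℕ) (hm : m ≠ 0)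
    (p : Nat.Primes) : ‖dirichletSummandHom χ hs0 p ^ m‖ ≤ 1 / 2 := by
  refine (norm_dirichletSummandHom_pow_le χ hs0 hs m hm p).trans ?_
  have := prime_rpow_le_half hs p
  exact (mul_le_of_le_one_left (Real.rpow_nonneg (Nat.cast_nonneg _) _)
    (pow_le_one₀ (by norm_num) (by norm_num))).trans this

lemma summable_norm_arrays (r : ℕ∞) (hs0 : s ≠ 0) (hs : 1 < s.re) :
    Summable fun a : Nat.Primes × RowCell r →₀ ℕ =>
      ‖dirichletSummandHom χ hs0 (arrayNumber a)‖ := by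
  simp only [dirichletSummandHom_arrayNumber]
  exact summable_norm_finsupp_geometric
    (fun c => norm_dirichletSummandHom_pow_le_half χ hs0 hs _ (Nat.succ_ne_zero _) c.1)
    (summable_norm_cells χ r hs0 hs)

/-- Convergence forces finiteness: for the character modulo `1` and `s = 2`, all arrays with number
`n ≠ 0` give the same nonzero term of a summable family. -/
lemma finite_arrays (r : ℕ∞) (n : ℕ) :
    Finite {a : Nat.Primes × RowCell r →₀ ℕ // arrayNumber a = n} := by
  rcases eq_or_ne n 0 with rfl | hn
  · exact @Finite.of_subsingleton _ ⟨fun a => (arrayNumber_ne_zero _ a.2).elim⟩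
  have hs0 : (2 : ℂ) ≠ 0 := two_ne_zero
  have h := summable_norm_arrays (1 : DirichletCharacter ℂ 1) r hs0 (by simp)
  have hpos : 0 < ‖dirichletSummandHom (1 : DirichletCharacter ℂ 1) hs0 n‖ := by
    rw [norm_pos_iff, dirichletSummandHom_apply']
    refine mul_ne_zero ?_ ?_
    · rw [Subsingleton.elim (n : ZMod 1) 1, map_one]
      exact one_ne_zero
    · rw [Complex.cpow_ne_zero_iff]
      exact Or.inl (Nat.cast_ne_zero.2 hn)
  have hev := h.tendsto_cofinite_zero.eventually (gt_mem_nhds hpos)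
  rw [Filter.eventually_cofinite] at hev
  refine Set.finite_coe_iff.2 (hev.subset fun a (ha : arrayNumber a = n) => ?_)
  rw [Set.mem_ofPred_eq, ha]
  exact lt_irrefl _

/-- Collect the arrays by their number: each fibre over `n` consists of equal terms, and its
cardinality is `a_r(n)`. -/
lemma lSeriesHasSum_groupPartition (r : ℕ∞) (hs0 : s ≠ 0) (hs : 1 < s.re) :
    LSeriesHasSum (groupPartitionCoeff r χ) s (∑' a : Nat.Primes × RowCell r →₀ ℕ,
      a.prod fun c v => (dirichletSummandHom χ hs0 c.1 ^ c.2.hook) ^ v) := by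
  have h := (summable_norm_arrays χ r hs0 hs).of_norm.hasSum.tsum_fiberwise arrayNumber
  simp only [← dirichletSummandHom_arrayNumber]
  rw [LSeriesHasSum]
  refine HasSum.congr_fun h fun n => ?_
  have h1 : ∀ a : (arrayNumber ⁻¹' {n} : Set (Nat.Primes × RowCell r →₀ ℕ)),
      dirichletSummandHom χ hs0 (arrayNumber a.1) = dirichletSummandHom χ hs0 n := fun a => by
    rw [show arrayNumber a.1 = n from a.2]
  simp only [h1]
  rw [tsum_const, nsmul_eq_mul]
  have h2 := groupPartitionFun_eq_card_array r n (finite_arrays r n)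
  rcases eq_or_ne n 0 with rfl | hn
  · simp
  · rw [LSeries.term_of_ne_zero hn, groupPartitionCoeff, dirichletSummandHom_apply', Complex.cpow_neg,
      h2]
    change _ = (Nat.card {a : Nat.Primes × RowCell r →₀ ℕ // arrayNumber a = n} : ℂ) * _
    ring

lemma hasProd_factors (r : ℕ∞) (hs0 : s ≠ 0) (hs : 1 < s.re) :
    HasProd (fun c : FactorIndex r => (1 - dirichletSummandHom χ hs0 c.1.2 ^ (c.1.1 : ℕ))⁻¹)
      (groupPartitionSeries r χ s) := by
  rw [groupPartitionSeries, (lSeriesHasSum_groupPartition χ r hs0 hs).LSeries_eq,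
    ← (cellFactorEquiv r).hasProd_iff]
  exact hasProd_one_sub_inv
    (fun c => norm_dirichletSummandHom_pow_le_half χ hs0 hs _ (Nat.succ_ne_zero _) c.1)
    (summable_norm_cells χ r hs0 hs)

lemma groupPartitionEulerFactor_eq (r : ℕ∞) (hs0 : s ≠ 0) (m p : ℕ) :
    groupPartitionEulerFactor r χ s m p =
      ((1 - dirichletSummandHom χ hs0 p ^ m)⁻¹) ^ minExponent m r := by
  rw [groupPartitionEulerFactor, dirichletSummandHom_apply', inv_pow, mul_pow, ← mul_neg,
    Complex.cpow_nat_mul]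

lemma hasProd_fin_factors (r : ℕ∞) (hs0 : s ≠ 0) (mp : ℕ+ × Nat.Primes) :
    HasProd (fun _ : Fin (minExponent mp.1 r) =>
      (1 - dirichletSummandHom χ hs0 mp.2 ^ (mp.1 : ℕ))⁻¹)
      (groupPartitionEulerFactor r χ s mp.1 mp.2) := by
  rw [groupPartitionEulerFactor_eq χ r hs0]
  have h := hasProd_fintype fun _ : Fin (minExponent mp.1 r) =>
    (1 - dirichletSummandHom χ hs0 mp.2 ^ (mp.1 : ℕ))⁻¹
  rwa [Finset.prod_const, Finset.card_univ, Fintype.card_fin] at h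

/-- This is a power of the Euler product of the `L`-series of `χ ^ m` at `m * s`, which lies in the
half-plane of convergence as `m ≥ 1`. That `m` is nonzero also gives `(χ ^ m) p = χ p ^ m` when `χ p
= 0`. -/
lemma hasProd_eulerFactor_prime (r : ℕ∞) (hs : 1 < s.re) (m : ℕ+) :
    HasProd (fun p : Nat.Primes => groupPartitionEulerFactor r χ s m p)
      (dirichletL (χ ^ (m : ℕ)) ((m : ℂ) * s) ^ minExponent m r) := by
  have hm : 1 < ((m : ℂ) * s).re := by
    have h1 : (1 : ℝ) ≤ (m : ℕ) := by exact_mod_cast m.pos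
    have h2 : ((m : ℂ) * s).re = (m : ℕ) * s.re := by
      rw [← Complex.re_ofReal_mul]
      simp
    rw [h2]
    nlinarith
  have h := (DirichletCharacter.LSeries_eulerProduct_hasProd (χ ^ (m : ℕ)) hm).pow (minExponent m r)
  refine HasProd.congr_fun h fun p => ?_
  rw [groupPartitionEulerFactor, MulChar.pow_apply' _ m.ne_zero, inv_pow]

end DirichletSeries

end

/-! ### Assembly of the product formulas. -/

theorem proposition3p1 (r : ℕ∞) (hr : 1 ≤ r) (N : ℕ) [NeZero N] (χ : DirichletCharacter ℂ N)
    (s : ℂ) (hs : 1 < s.re) :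
    -- the series `J_r(s, χ)` converges absolutely
    LSeriesSummable (groupPartitionCoeff r χ) s ∧
    -- the double product over `m` and `p` converges absolutely, with value `J_r(s, χ)`
    Summable (fun mp : ℕ+ × Nat.Primes => ‖groupPartitionEulerFactor r χ s mp.1 mp.2 - 1‖) ∧
    HasProd (fun mp : ℕ+ × Nat.Primes => groupPartitionEulerFactor r χ s mp.1 mp.2)
      (groupPartitionSeries r χ s) ∧
    -- the same for the iterated product, first over `p` and then over `m`
    (∀ m : ℕ+, HasProd (fun p : Nat.Primes => groupPartitionEulerFactor r χ s m p)
      (dirichletL (χ ^ (m : ℕ)) ((m : ℂ) * s) ^ minExponent m r)) ∧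
    HasProd (fun m : ℕ+ => ∏' p : Nat.Primes, groupPartitionEulerFactor r χ s m p)
      (groupPartitionSeries r χ s) ∧
    -- the product of `L`-series converges absolutely, with value `J_r(s, χ)`
    Summable (fun m : ℕ+ => ‖dirichletL (χ ^ (m : ℕ)) ((m : ℂ) * s) ^ minExponent m r - 1‖) ∧
    HasProd (fun m : ℕ+ => dirichletL (χ ^ (m : ℕ)) ((m : ℂ) * s) ^ minExponent m r)
      (groupPartitionSeries r χ s) := by
  have hs0 : s ≠ 0 := by
    rintro rfl
    simp at hs
    linarith
  -- Absolute convergence of the product with every factor repeated; grouping equal factors, then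
  -- all primes for fixed `m`, transfers it to the other two products.
  have hfac : Summable fun c : FactorIndex r =>
      ‖(1 - dirichletSummandHom χ hs0 c.1.2 ^ (c.1.1 : ℕ))⁻¹ - 1‖ :=
    Summable.of_nonneg_of_le (fun _ => norm_nonneg _)
      (fun c => norm_one_sub_inv_sub_one_le
        (norm_dirichletSummandHom_pow_le_half χ hs0 hs _ c.1.1.ne_zero c.1.2))
      ((summable_norm_factors χ r hs0 hs).mul_left 2)
  have h2 : Summable fun mp : ℕ+ × Nat.Primes =>
      ‖groupPartitionEulerFactor r χ s mp.1 mp.2 - 1‖ :=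
    summable_norm_sub_one_of_hasProd_sigma hfac (hasProd_fin_factors χ r hs0)
  have h3 : HasProd (fun mp : ℕ+ × Nat.Primes => groupPartitionEulerFactor r χ s mp.1 mp.2)
      (groupPartitionSeries r χ s) :=
    (hasProd_factors χ r hs0 hs).sigma (hasProd_fin_factors χ r hs0)
  have h4 := hasProd_eulerFactor_prime χ r hs
  have h7 : HasProd (fun m : ℕ+ => dirichletL (χ ^ (m : ℕ)) ((m : ℂ) * s) ^ minExponent m r)
      (groupPartitionSeries r χ s) := h3.prod_fiberwise h4
  refine ⟨(lSeriesHasSum_groupPartition χ r hs0 hs).LSeriesSummable, h2, h3, h4, ?_, ?_, h7⟩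
  · simpa only [fun m => (h4 m).tprod_eq] using h7
  · exact summable_norm_sub_one_of_hasProd_sigma
      (u := fun c : Σ _ : ℕ+, Nat.Primes => groupPartitionEulerFactor r χ s c.1 c.2)
      ((Equiv.sigmaEquivProd ℕ+ Nat.Primes).summable_iff.2 h2) h4
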